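/- Let $K$ be a field and $\mathcal T$ a $K$-linear triangulated category. For a class $S$ of objects let $\langle S\rangle$ be the smallest strictly full triangulated subcategory containing $S$ (closure under direct summands is not required), and let $\hat E$ be the extension closure of an object $E$ (the smallest class containing $E$ and $0$ and closed under isomorphisms and extensions). An object $E$ is exceptional if $\mathrm{Hom}(E,E)=K\cdot\mathrm{id}_E\cong K$ and $\mathrm{Hom}(E,E[k])=0$ for $k\ne 0$. Let $\sigma=(Z,\mathcal P)$ be a Bridgeland stability condition on $\mathcal T$ (not necessarily locally finite), $\sigma^{ss}$ the set of its semistable objects (the non-zero objects of the subcategories $\mathcal P(t)$, $t\in\mathbb R$), and $\phi(A)=t$ for $0\neq A\in\mathcal P(t)$. Let $\mathcal E=(E_0,\dots,E_n)$ be a full $\sigma$-exceptional collection, that is: every $E_i$ is exceptional and lies in $\sigma^{ss}$; $\mathrm{Hom}(E_i,E_j[k])=0$ for all $i>j$ and all $k\in\mathbb Z$; $\langle E_0,\dots,E_n\rangle=\mathcal T$; $\mathrm{Hom}(E_i,E_j[k])=0$ for all $i\ne j$ and $k\le 0$; and there is $t\in\mathbb R$ with $\phi(E_i)\in(t,t+1]$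 for all $i$. Assume that $\phi(E_0)<\phi(E_1)<\dots<\phi(E_n)$. Then: 1. $\mathcal P(\phi(E_i)+j)=\hat E_i[j]$ for all $0\le i\le n$ and $j\in\mathbb Z$, and $\mathcal P(t)=\{0\}$ for every other $t\in\mathbb R$. 2. Call the subcategories $\langle E\rangle$ with $E$ exceptional the derived points of $\mathcal T$, and let $C_{D^b(pt),\sigma\sigma}(\mathcal T)$ be the set of those $\langle E\rangle$ with $E$ exceptional and $E\in\sigma^{ss}$. Then $C_{D^b(pt),\sigma\sigma}(\mathcal T)=\{\langle E_0\rangle,\dots,\langle E_n\rangle\}$; in particular this set is finite. 3. For $l\ge 0$ let $N\mathbb P^l=D^b(\mathrm{Rep}_K(K(l+1)))$ be the bounded derived category of finite-dimensional representations over $K$ of the Kronecker quiver with $l+1$ arrows, and let $\mathcal X$ be a set of exceptional objects of $N\mathbb P^l$ such that every exceptional object is isomorphic to a shift of exactly one element of $\mathcal X$. Let $C_l(\mathcal T)$ be the set of fully faithful exact $K$-linear functors $F:N\mathbb P^l\to\mathcal T$ modulo $F\sim F'\iff F\circ\alpha\cong F'$ (as exact functors) for some exact auto-equivalence $\alpha$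 of $N\mathbb P^l$, let $C_{l,\sigma}(\mathcal T)\subset C_l(\mathcal T)$ be the set of classes of those $F$ with $F(X)\in\sigma^{ss}$ for infinitely many $X\in\mathcal X$, and let $C_{l,\sigma\sigma}(\mathcal T)\subset C_l(\mathcal T)$ be the set of classes of those $F$ with $F(X)\in\sigma^{ss}$ for all $X\in\mathcal X$. Then $C_{l,\sigma\sigma}(\mathcal T)=C_{l,\sigma}(\mathcal T)=\emptyset$ for all $l\ge 0$. -/

import Mathlib

open CategoryTheory Limits Pretriangulated

universe u v w

noncomputable section

/-! ### Triangulated subcategories, extension closures, Grothendieck group -/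

section Triangulated

variable {T : Type u} [Category.{v} T] [HasZeroObject T] [HasShift T ℤ] [Preadditive T]
  [∀ n : ℤ, (shiftFunctor T n).Additive] [Pretriangulated T]

/-- `⟨S⟩`: the smallest strictly full triangulated subcategory of `T` containing all objects of `S`
(closed under shifts in both directions, under isomorphisms and under extensions; closure
under direct summands is not imposed). -/
def triangulatedSpan (S : Set T) : ObjectProperty T := fun X =>
  ∀ P : ObjectProperty T, P.IsTriangulated → P.IsClosedUnderIsomorphisms →
    (∀ Y ∈ S, P Y) → P X

/-- The extension closure of a class `S` of objects: the smallest class of objects which contains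
`S` and the zero objects and contains the middle term of every distinguished triangle whose outer
terms it contains. It is closed under isomorphisms, since `X ≅ Z` gives a distinguished
triangle `X → Z → 0 → X⟦1⟧`. -/
inductive ExtensionClosure (S : Set T) : ObjectProperty T
  | zero (X : T) (hX : IsZero X) : ExtensionClosure S X
  | of (X : T) (hX : X ∈ S) : ExtensionClosure S X
  | ext (Δ : Triangle T) (hΔ : Δ ∈ distTriang T) (h₁ : ExtensionClosure S Δ.obj₁)
      (h₃ : ExtensionClosure S Δ.obj₃) : ExtensionClosure S Δ.obj₂

/-- `Ê[j]`, where `Ê` is the extension closure of the object `E`: all objects isomorphic to `Y⟦j⟧`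
for some `Y` in `Ê`. -/
def shiftedExtensionClosure (E : T) (j : ℤ) : ObjectProperty T := fun X =>
  ∃ Y : T, ExtensionClosure {E} Y ∧ Nonempty (X ≅ Y⟦j⟧)

variable (T) in
/-- The relations `[Y] - [X] - [Z]`, one for each distinguished triangle `X → Y → Z → X⟦1⟧`. -/
def K₀Relations : AddSubgroup (FreeAbelianGroup T) :=
  AddSubgroup.closure {x | ∃ Δ : Triangle T, Δ ∈ distTriang T ∧
    x = FreeAbelianGroup.of Δ.obj₂ - FreeAbelianGroup.of Δ.obj₁ - FreeAbelianGroup.of Δ.obj₃}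

variable (T) in
/-- The Grothendieck group `K₀(T)` of a triangulated category. -/
abbrev K₀ : Type u := FreeAbelianGroup T ⧸ K₀Relations T

/-- The class of an object in the Grothendieck group. -/
def K₀.cls (X : T) : K₀ T := QuotientAddGroup.mk' (K₀Relations T) (FreeAbelianGroup.of X)

/-! ### Slicings and stability conditions -/

/-- A Harder–Narasimhan filtration of `X` with respect to a family `P` of classes of objects: a chain
`0 = X₀ → X₁ → ⋯ → Xₙ = X` whose `i`-th cone is a non-zero object of `P (φ i)`,
with strictly decreasing `φ`. -/
def HasHNFiltration (P : ℝ → ObjectProperty T) (X : T) : Prop :=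
  ∃ (n : ℕ) (F : Fin (n + 1) → T) (A : Fin n → T) (φ : Fin n → ℝ),
    StrictAnti φ ∧ IsZero (F 0) ∧ Nonempty (F (Fin.last n) ≅ X) ∧
    ∀ i : Fin n, P (φ i) (A i) ∧ ¬ IsZero (A i) ∧
      ∃ (f : F i.castSucc ⟶ F i.succ) (g : F i.succ ⟶ A i) (h : A i ⟶ (F i.castSucc)⟦(1 : ℤ)⟧),
        Triangle.mk f g h ∈ distTriang T

variable (T) in
/-- A slicing of a triangulated category. -/
structure Slicing where
  /-- The full subcategory `P(φ)`, given by its class of objects. -/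
  P : ℝ → ObjectProperty T
  /-- `P(φ)` is strictly full. -/
  closedUnderIso (φ : ℝ) : (P φ).IsClosedUnderIsomorphisms
  /-- `P(φ)` is an additive subcategory: it contains the zero objects and is closed under finite
  direct sums (which are finite products). -/
  additive (φ : ℝ) : (P φ).IsClosedUnderFiniteProducts
  /-- `P(φ)[1] = P(φ + 1)`. -/
  shift_iff (φ : ℝ) (X : T) : P (φ + 1) (X⟦(1 : ℤ)⟧) ↔ P φ X
  /-- There are no non-zero morphisms from higher to lower phase. -/
  hom_eq_zero {φ ψ : ℝ} (h : ψ < φ) {X Y : T} (hX : P φ X) (hY : P ψ Y) (f : X ⟶ Y) : f = 0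
  /-- Every non-zero object has a Harder–Narasimhan filtration. -/
  exists_hn (X : T) (hX : ¬ IsZero X) : HasHNFiltration P X

variable (T) in
/-- A Bridgeland stability condition `σ = (Z, P)`; local finiteness is not imposed. -/
structure StabilityCondition extends Slicing T where
  /-- The central charge. -/
  Z : K₀ T →+ ℂ
  compat (t : ℝ) (A : T) (hA : P t A) (h0 : ¬ IsZero A) :
    ∃ m : ℝ, 0 < m ∧ Z (K₀.cls A) = (m : ℂ) * Complex.exp (Complex.I * Real.pi * t)

namespace StabilityCondition

/-- `A ∈ σ^{ss}`: `A` is a non-zero object of some `P(t)`. -/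
def IsSemistable (σ : StabilityCondition T) (A : T) : Prop :=
  ¬ IsZero A ∧ ∃ t : ℝ, σ.P t A

open Classical in
/-- The phase `φ_σ(A)` of a semistable object `A` (and `0` if `A` is not semistable). -/
def phase (σ : StabilityCondition T) (A : T) : ℝ :=
  if h : σ.IsSemistable A then h.2.choose else 0

/-- The phase of a non-zero object of `P(t)` is `t`. -/
theorem phase_eq (σ : StabilityCondition T) {A : T} {t : ℝ} (hA : σ.P t A) (h0 : ¬ IsZero A) :
    σ.phase A = t := by
  have h : σ.IsSemistable A := ⟨h0, t, hA⟩
  have hp : σ.P (σ.phase A) A := by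
    rw [phase, dif_pos h]
    exact h.2.choose_spec
  rcases lt_trichotomy (σ.phase A) t with hlt | heq | hgt
  · exact absurd ((IsZero.iff_id_eq_zero A).2 (σ.hom_eq_zero hlt hA hp (𝟙 A))) h0
  · exact heq
  · exact absurd ((IsZero.iff_id_eq_zero A).2 (σ.hom_eq_zero hgt hp hA (𝟙 A))) h0

end StabilityCondition

end Triangulated

/-! ### Exceptional objects and exceptional collections -/

section Exceptional

variable (K : Type w) [Field K] {T : Type u} [Category.{v} T] [HasShift T ℤ] [Preadditive T]
  [Linear K T]

/-- An exceptional object: `Hom(E, E) = K` and `Hom(E, E[k]) = 0` for `k ≠ 0`. -/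
structure IsExceptionalObject (E : T) : Prop where
  end_eq : Function.Bijective fun c : K => c • 𝟙 E
  hom_eq_zero (k : ℤ) (hk : k ≠ 0) (f : E ⟶ E⟦k⟧) : f = 0

/-- An exceptional collection `(E₀, …, Eₙ)`. -/
structure IsExceptionalCollection {n : ℕ} (E : Fin (n + 1) → T) : Prop where
  exceptional (i : Fin (n + 1)) : IsExceptionalObject K (E i)
  hom_eq_zero (i j : Fin (n + 1)) (hij : j < i) (k : ℤ) (f : E i ⟶ (E j)⟦k⟧) : f = 0

variable {K} in
/-- `X` is isomorphic to some shift of `Y`. -/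
def IsShiftOf (X Y : T) : Prop := ∃ k : ℤ, Nonempty (X ≅ Y⟦k⟧)

/-- `𝓔` is a set of exceptional objects such that every exceptional object is isomorphic to a
shift of exactly one element of `𝓔`. -/
structure IsExceptionalTransversal (𝓔 : Set T) : Prop where
  exceptional (E : T) (hE : E ∈ 𝓔) : IsExceptionalObject K E
  existsUnique (X : T) (hX : IsExceptionalObject K X) : ∃! Y : T, Y ∈ 𝓔 ∧ IsShiftOf X Y

/-- Such a set exists. -/
theorem exists_isExceptionalTransversal : ∃ 𝓔 : Set T, IsExceptionalTransversal K 𝓔 := by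
  have hrefl (X : T) : IsShiftOf X X := ⟨0, ⟨((shiftFunctorZero T ℤ).app X).symm⟩⟩
  have hsymm {X Y : T} : IsShiftOf X Y → IsShiftOf Y X := fun ⟨k, ⟨e⟩⟩ =>
    ⟨-k, ⟨(shiftShiftNeg Y k).symm ≪≫ (shiftFunctor T (-k)).mapIso e.symm⟩⟩
  have htrans {X Y Z : T} : IsShiftOf X Y → IsShiftOf Y Z → IsShiftOf X Z :=
    fun ⟨k, ⟨e⟩⟩ ⟨m, ⟨e'⟩⟩ =>
      ⟨m + k, ⟨e ≪≫ (shiftFunctor T k).mapIso e' ≪≫ ((shiftFunctorAdd T m k).app Z).symm⟩⟩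
  let s : Setoid {X : T // IsExceptionalObject K X} :=
    { r := fun X Y => IsShiftOf X.1 Y.1
      iseqv := ⟨fun X => hrefl X.1, hsymm, htrans⟩ }
  refine ⟨Set.range fun q : Quotient s => q.out.1, ?_, ?_⟩
  · rintro _ ⟨q, rfl⟩
    exact q.out.2
  · intro X hX
    have hq : IsShiftOf (⟦⟨X, hX⟩⟧ : Quotient s).out.1 X := Quotient.mk_out (s := s) ⟨X, hX⟩
    refine ⟨_, ⟨⟨_, rfl⟩, hsymm hq⟩, ?_⟩
    rintro _ ⟨⟨q, rfl⟩, hXq⟩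
    have : q = ⟦⟨X, hX⟩⟧ := by
      rw [← q.out_eq]
      exact Quotient.sound (s := s) (hsymm hXq)
    rw [this]

end Exceptional

section SigmaExceptional

variable (K : Type w) [Field K] {T : Type u} [Category.{v} T] [HasZeroObject T] [HasShift T ℤ]
  [Preadditive T] [Linear K T] [∀ n : ℤ, (shiftFunctor T n).Additive] [Pretriangulated T]

/-- A full exceptional collection: it generates `T` as a triangulated category. -/
structure IsFullExceptionalCollection {n : ℕ} (E : Fin (n + 1) → T) : Prop
    extends IsExceptionalCollection K E where
  full : triangulatedSpan (Set.range E) = ⊤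

/-- A `σ`-exceptional collection. -/
structure IsSigmaExceptionalCollection (σ : StabilityCondition T) {n : ℕ}
    (E : Fin (n + 1) → T) : Prop extends IsExceptionalCollection K E where
  semistable (i : Fin (n + 1)) : σ.IsSemistable (E i)
  ext_exceptional (i j : Fin (n + 1)) (hij : i ≠ j) (k : ℤ) (hk : k ≤ 0)
    (f : E i ⟶ (E j)⟦k⟧) : f = 0
  exists_phase_mem : ∃ t : ℝ, ∀ i, σ.phase (E i) ∈ Set.Ioc t (t + 1)

/-- `C_{D^b(pt), K}(T)`: the derived points of `T`, i.e. the full triangulated subcategories generated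
by one exceptional object. -/
def derivedPoints (T : Type u) [Category.{v} T] [HasZeroObject T] [HasShift T ℤ]
    [Preadditive T] [Linear K T] [∀ n : ℤ, (shiftFunctor T n).Additive] [Pretriangulated T] :
    Set (ObjectProperty T) :=
  {A | ∃ E : T, IsExceptionalObject K E ∧ A = triangulatedSpan {E}}

/-- `C_{D^b(pt), σσ}(T)`: the `σ`-semistable derived points, `⟨E⟩` with `E` exceptional and
semistable. -/
def stableDerivedPoints (σ : StabilityCondition T) : Set (ObjectProperty T) :=
  {A | A ∈ derivedPoints K T ∧
    ∃ E : T, IsExceptionalObject K E ∧ A = triangulatedSpan {E} ∧ σ.IsSemistable E}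

end SigmaExceptional

/-! ### The bounded derived category of the Kronecker quiver -/

/-- The two vertices of the Kronecker quiver `K(m)`. -/
inductive KroneckerVertex (m : ℕ) : Type
  | source : KroneckerVertex m
  | sink : KroneckerVertex m

/-- The arrows of the Kronecker quiver `K(m)`: exactly `m` arrows from `source` to `sink`. -/
def KroneckerVertex.Arrow {m : ℕ} : KroneckerVertex m → KroneckerVertex m → Type
  | .source, .sink => Fin m
  | _, _ => Empty

instance (m : ℕ) : Quiver (KroneckerVertex m) where
  Hom := KroneckerVertex.Arrow

section Kronecker

variable (K : Type w) [Field K]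

/-- `Rep_K(K(m))`: the abelian category of finite-dimensional representations over `K` of the
Kronecker quiver with `m` arrows, as functors from its path category. -/
abbrev KroneckerRep (m : ℕ) := Paths (KroneckerVertex m) ⥤ FGModuleCat.{w} K

instance (m : ℕ) : HasDerivedCategory.{w + 1} (KroneckerRep K m) :=
  HasDerivedCategory.standard _

/-- `Nℙ^l = D^b(Rep_K(K(l+1)))`. -/
abbrev NP (l : ℕ) := DerivedCategory.Bounded (KroneckerRep K (l + 1))

end Kronecker

/-! ### Non-commutative curves -/

section Curves

variable (K : Type w) [Field K] (l : ℕ) (T : Type u) [Category.{v} T] [HasZeroObject T]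
  [HasShift T ℤ] [Preadditive T] [Linear K T] [∀ n : ℤ, (shiftFunctor T n).Additive]
  [Pretriangulated T]

/-- `C'_l(T)`: fully faithful exact `K`-linear functors `Nℙ^l ⥤ T`. -/
structure CurveFunctor where
  functor : NP K l ⥤ T
  [commShift : functor.CommShift ℤ]
  [isTriangulated : functor.IsTriangulated]
  [full : functor.Full]
  [faithful : functor.Faithful]
  [linear : functor.Linear K]

attribute [instance] CurveFunctor.commShift CurveFunctor.isTriangulated CurveFunctor.full
  CurveFunctor.faithful CurveFunctor.linear

variable {K l T}

/-- `F ∼ F'` iff `F ∘ α ≅ F'`, as exact (graded) functors, for some exact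
auto-equivalence `α` of `Nℙ^l`. -/
def CurveFunctor.Equivalent (F F' : CurveFunctor K l T) : Prop :=
  ∃ (α : NP K l ⥤ NP K l) (_ : α.CommShift ℤ) (_ : α.IsTriangulated) (_ : α.IsEquivalence)
    (e : α ⋙ F.functor ≅ F'.functor), NatTrans.CommShift e.hom ℤ

variable (K l T) in
/-- `C_l(T)`: the non-commutative curves of genus `l` in `T`. -/
def NCCurve := Quot (CurveFunctor.Equivalent (K := K) (l := l) (T := T))

/-- `C'_{l,σ}(T)`: the functors `F` for which `F(E)` is `σ`-semistable for infinitely many `E ∈ 𝓔`. -/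
def semistableCurveFunctors (σ : StabilityCondition T) (𝓔 : Set (NP K l)) :
    Set (CurveFunctor K l T) :=
  {F | {E | E ∈ 𝓔 ∧ σ.IsSemistable (F.functor.obj E)}.Infinite}

/-- `C'_{l,σσ}(T)`: the functors `F` for which `F(E)` is `σ`-semistable for all `E ∈ 𝓔`. -/
def stableCurveFunctors (σ : StabilityCondition T) (𝓔 : Set (NP K l)) :
    Set (CurveFunctor K l T) :=
  {F | ∀ E ∈ 𝓔, σ.IsSemistable (F.functor.obj E)}

/-- `C_{l,σ}(T)`: the `σ`-semistable non-commutative curves of genus `l`, where `𝓔` represents the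
exceptional objects of `Nℙ^l` up to shift and isomorphism. -/
def semistableCurves (σ : StabilityCondition T) (𝓔 : Set (NP K l)) : Set (NCCurve K l T) :=
  Quot.mk _ '' semistableCurveFunctors σ 𝓔

/-- `C_{l,σσ}(T)`: the `σ`-stable non-commutative curves of genus `l`, where `𝓔` represents the
exceptional objects of `Nℙ^l` up to shift and isomorphism. -/
def stableCurves (σ : StabilityCondition T) (𝓔 : Set (NP K l)) : Set (NCCurve K l T) :=
  Quot.mk _ '' stableCurveFunctors σ 𝓔

end Curves

end

/-!
Write `φᵢ` for the phase of `Eᵢ`. The proof rests on sorted filtrations: every object of `T` is an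
iterated extension of shifts `Eᵢ[j]`, arranged so that the phases `φᵢ + j` decrease, with the piece
of highest phase as the first subobject. Indeed, if a piece `A` of lower phase precedes a piece `B`
of higher phase, then every morphism `B ⟶ A[1]` is zero or invertible
(`IsSigmaExceptionalCollection.eq_zero_or_isIso`): the phases lie in an interval of length `1` and
increase with the index, so such a morphism has non-positive degree, or has degree one and goes
backwards in the collection, unless it is a scalar endomorphism of a shift of one `Eᵢ`. So
neighbouring pieces in the wrong order can be exchanged, or cancel each other, and the objects with
a sorted filtration are closed under extensions (`PhaseFiltered.extension`); as they form a
triangulated subcategory that contains the `Eᵢ`, they are all objects.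

Such a filtration is a Harder–Narasimhan filtration up to grouping pieces of equal phase, so for an
object of `P(t)` only pieces of phase `t` occur (`Slicing.extensionClosure_of_phaseFiltered`). This
computes the slicing: the `φᵢ + j` are pairwise distinct, and iterated self-extensions of `Eᵢ[j]`
split, so that they lie in `P(φᵢ + j)` and have `Eᵢ[j]` as a direct summand when they are non-zero.
Consequently a semistable exceptional object is a shift of some `Eᵢ`
(`IsSigmaExceptionalCollection.exists_isShiftOf`), which determines the semistable derived points.

A fully faithful exact functor `F` preserves exceptional objects and reflects being shifts of each
other, so at most `n + 1` of the objects `X` in `𝓔` have a semistable image, and no curve is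
semistable. For the emptiness of the set of stable curves, for which `𝓔` may be finite, consider the
representations `S'` (simple at the sink), `P` (projective cover of the simple at the source) and
`S` (simple at the source). They are exceptional, being projective or injective with scalar
endomorphisms, and there are non-zero morphisms `S' ⟶ P ⟶ S ⟶ S'[1]`. If all of their images were
shifts of members of the collection, the indices of these members would increase weakly around the
cycle, hence coincide, and `S` would be a shift of `S'`
(`IsSigmaExceptionalCollection.not_forall_semistable`), which it is not.
-/

noncomputable section

section Triangulated

variable {T : Type u} [Category.{v} T] [HasZeroObject T] [HasShift T ℤ] [Preadditive T]
  [∀ n : ℤ, (shiftFunctor T n).Additive] [Pretriangulated T]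

open scoped ZeroObject

/-! ### Extension closures and spans of objects up to shift -/

omit [HasShift T ℤ] [HasZeroObject T] [Pretriangulated T] [Preadditive T]
  [∀ n : ℤ, (shiftFunctor T n).Additive] in
/-- A zero object is the product of the empty family. -/
theorem prop_of_isZero_of_isClosedUnderFiniteProducts (P : ObjectProperty T)
    [P.IsClosedUnderFiniteProducts] {X : T} (hX : IsZero X) : P X :=
  P.prop_of_isLimit_fan (J := Empty) (f := Empty.elim) (F := Fan.mk X fun j => j.elim)
    (Fan.IsLimit.mk _ (fun _ => hX.from_ _) (fun _ j => j.elim) fun _ _ _ => hX.eq_of_tgt _ _)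
    fun j => j.elim

namespace ExtensionClosure

variable {S : Set T}

theorem of_iso {X Y : T} (e : X ≅ Y) (hX : ExtensionClosure S X) : ExtensionClosure S Y :=
  ext (Triangle.mk e.hom (0 : Y ⟶ 0) 0)
    ((Triangle.distinguished_iff_of_isZero₃ _ (isZero_zero T)).2 (inferInstanceAs (IsIso e.hom)))
    hX (zero _ (isZero_zero T))

theorem shift {X E E' : T} (hX : ExtensionClosure {E} X) (j : ℤ) (e : E⟦j⟧ ≅ E') :
    ExtensionClosure {E'} (X⟦j⟧) := by
  induction hX with
  | zero X hX => exact zero _ ((shiftFunctor T j).map_isZero hX)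
  | of X hX =>
    obtain rfl : X = E := hX
    exact of_iso e.symm (of _ rfl)
  | ext Δ hΔ _ _ h₁ h₃ =>
    exact ext _ (Triangle.shift_distinguished Δ hΔ j) h₁ h₃

theorem isZero_of_empty {X : T} (hX : ExtensionClosure (∅ : Set T) X) : IsZero X := by
  induction hX with
  | zero X hX => exact hX
  | of X hX => exact hX.elim
  | ext Δ hΔ _ _ h₁ h₃ => exact Triangle.isZero₂_of_isZero₁₃ Δ hΔ h₁ h₃

/-- If `E` has no morphism to `Y` then neither does any iterated self-extension of `E`. -/
theorem hom_eq_zero {E X Y : T} (hX : ExtensionClosure {E} X) (h : ∀ f : E ⟶ Y, f = 0)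
    (f : X ⟶ Y) : f = 0 := by
  induction hX with
  | zero X hX => exact hX.eq_of_src _ _
  | of X hX =>
    obtain rfl : X = E := hX
    exact h f
  | ext Δ hΔ _ _ h₁ h₃ =>
    obtain ⟨g, rfl⟩ := Triangle.yoneda_exact₂ Δ hΔ f (h₁ _)
    rw [h₃ g, comp_zero]

/-- If `E` has no self-extensions then neither do the iterated self-extensions of `E`. -/
theorem hom_shift_eq_zero {E X Y : T} (hE : ∀ f : E ⟶ E⟦(1 : ℤ)⟧, f = 0)
    (hX : ExtensionClosure {E} X) (hY : ExtensionClosure {E} Y) (f : X ⟶ Y⟦(1 : ℤ)⟧) : f = 0 := by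
  refine hX.hom_eq_zero (fun g => ?_) f
  clear f
  induction hY with
  | zero Y hY => exact ((shiftFunctor T (1 : ℤ)).map_isZero hY).eq_of_tgt _ _
  | of Y hY =>
    obtain rfl : Y = E := hY
    exact hE g
  | ext Δ hΔ _ _ h₁ h₃ =>
    obtain ⟨k, rfl⟩ := Triangle.coyoneda_exact₂ _ (Triangle.shift_distinguished Δ hΔ 1) g (h₃ _)
    exact (congrArg (· ≫ _) (h₁ k)).trans zero_comp

/-- The iterated self-extensions of an object `E` without self-extensions are the finite direct
sums of copies of `E`, so they belong to every additive subcategory that contains `E`. -/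
theorem prop_of_isClosedUnderFiniteProducts {E X : T} (hE : ∀ f : E ⟶ E⟦(1 : ℤ)⟧, f = 0)
    (P : ObjectProperty T) [P.IsClosedUnderFiniteProducts] [P.IsClosedUnderIsomorphisms]
    (hP : P E) (hX : ExtensionClosure {E} X) : P X := by
  induction hX with
  | zero X hX => exact prop_of_isZero_of_isClosedUnderFiniteProducts P hX
  | of X hX =>
    obtain rfl : X = E := hX
    exact hP
  | ext Δ hΔ h₁ h₃ ih₁ ih₃ =>
    obtain ⟨e, -⟩ := exists_iso_binaryBiproduct_of_distTriang Δ hΔ (hom_shift_eq_zero hE h₃ h₁ _)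
    exact P.prop_of_iso (e ≪≫ biprod.isoProd _ _).symm (P.prop_prod _ _ ih₁ ih₃)

/-- A non-zero iterated self-extension of an object `E` without self-extensions has `E` as a
direct summand. -/
theorem nonempty_retract {E X : T} (hE : ∀ f : E ⟶ E⟦(1 : ℤ)⟧, f = 0)
    (hX : ExtensionClosure {E} X) (h0 : ¬ IsZero X) : Nonempty (Retract E X) := by
  induction hX with
  | zero X hX => exact absurd hX h0
  | of X hX =>
    obtain rfl : X = E := hX
    exact ⟨Retract.refl _⟩
  | ext Δ hΔ h₁ h₃ ih₁ ih₃ =>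
    obtain ⟨e, -⟩ := exists_iso_binaryBiproduct_of_distTriang Δ hΔ (hom_shift_eq_zero hE h₃ h₁ _)
    by_cases hz : IsZero Δ.obj₁
    · have hz' : ¬ IsZero Δ.obj₃ := fun h => h0 (Triangle.isZero₂_of_isZero₁₃ Δ hΔ hz h)
      obtain ⟨r⟩ := ih₃ hz'
      exact ⟨r.trans (Retract.trans ⟨biprod.inr, biprod.snd, by simp⟩ (Retract.ofIso e.symm))⟩
    · obtain ⟨r⟩ := ih₁ hz
      exact ⟨r.trans (Retract.trans ⟨biprod.inl, biprod.fst, by simp⟩ (Retract.ofIso e.symm))⟩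

end ExtensionClosure

theorem shiftedExtensionClosure_of_extensionClosure {E X : T} {j : ℤ}
    (hX : ExtensionClosure {E⟦j⟧} X) : shiftedExtensionClosure E j X :=
  ⟨X⟦-j⟧, hX.shift (-j) (shiftShiftNeg E j), ⟨(shiftNegShift X j).symm⟩⟩

theorem triangulatedSpan_singleton_le_of_isShiftOf {X Y : T} (h : IsShiftOf X Y) :
    triangulatedSpan {X} ≤ triangulatedSpan {Y} := by
  obtain ⟨k, ⟨e⟩⟩ := h
  intro A hA P hP hP' hY
  refine hA P hP hP' fun X' hX' => ?_
  obtain rfl : X' = X := hX'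
  exact P.prop_of_iso e.symm (P.le_shift k _ (hY Y rfl))

omit [HasZeroObject T] [Pretriangulated T] [Preadditive T]
  [∀ n : ℤ, (shiftFunctor T n).Additive] in
theorem IsShiftOf.symm {X Y : T} : IsShiftOf X Y → IsShiftOf Y X := fun ⟨k, ⟨e⟩⟩ =>
  ⟨-k, ⟨(shiftShiftNeg Y k).symm ≪≫ (shiftFunctor T (-k)).mapIso e.symm⟩⟩

theorem triangulatedSpan_singleton_eq_of_isShiftOf {X Y : T} (h : IsShiftOf X Y) :
    triangulatedSpan {X} = triangulatedSpan {Y} :=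
  le_antisymm (triangulatedSpan_singleton_le_of_isShiftOf h)
    (triangulatedSpan_singleton_le_of_isShiftOf h.symm)

/-! ### Filtrations by a family of objects sorted by phase -/

/-- The isomorphism class of an object. -/
def isoClass (A : T) : ObjectProperty T := fun X => Nonempty (X ≅ A)

theorem extensionProduct_isoClass_iff (A : T) (Q : ObjectProperty T) (X : T) :
    (isoClass A).extensionProduct Q X ↔
      ∃ (Z : T) (f : A ⟶ X) (g : X ⟶ Z) (h : Z ⟶ A⟦(1 : ℤ)⟧),
        Triangle.mk f g h ∈ distTriang T ∧ Q Z := by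
  constructor
  · rintro ⟨Y, Z, f, g, h, hT, ⟨e⟩, hZ⟩
    refine ⟨Z, e.inv ≫ f, g, h ≫ e.hom⟦1⟧', ?_, hZ⟩
    refine isomorphic_distinguished _ hT _ (Triangle.isoMk _ _ e.symm (Iso.refl _) (Iso.refl _)
      (Category.comp_id _) ((Category.comp_id g).trans (Category.id_comp g).symm) ?_)
    change (h ≫ e.hom⟦1⟧') ≫ e.inv⟦1⟧' = 𝟙 Z ≫ h
    simp [← Functor.map_comp]
  · rintro ⟨Z, f, g, h, hT, hZ⟩
    exact ⟨A, Z, f, g, h, hT, ⟨Iso.refl _⟩, hZ⟩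

/-- If every morphism `B ⟶ A⟦1⟧` is zero or invertible, then an extension of `B` by `A` is zero or
splits, in which case it is also an extension of `A` by `B`. -/
theorem isZero_or_extensionProduct_swap {A B X : T}
    (h : ∀ f : B ⟶ A⟦(1 : ℤ)⟧, f = 0 ∨ IsIso f)
    (hX : (isoClass A).extensionProduct (isoClass B) X) :
    IsZero X ∨ (isoClass B).extensionProduct (isoClass A) X := by
  obtain ⟨Z, f, g, k, hT, ⟨e⟩⟩ := (extensionProduct_isoClass_iff _ _ _).1 hX
  rcases h (e.inv ≫ k) with h0 | hi
  · right
    have hk : k = 0 := by rw [← cancel_epi e.inv, h0, comp_zero]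
    obtain ⟨e', -⟩ := exists_iso_binaryBiproduct_of_distTriang _ hT hk
    refine ObjectProperty.prop_of_iso _ (e' ≪≫ biprod.braiding _ _).symm ?_
    exact ⟨_, _, _, _, _, binaryBiproductTriangle_distinguished Z A, ⟨e⟩, ⟨Iso.refl _⟩⟩
  · left
    have : IsIso k := by
      rw [← Iso.hom_inv_id_assoc e k]
      infer_instance
    exact Triangle.isZero₂_of_isIso₃ _ hT this

variable {ι : Type*}

/-- `PhaseFiltered G p s X`: the object `X` is an iterated extension of members of the family `G`,
each of which carries a phase given by `p`; the successive subquotients have weakly decreasing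
phases, all of them at most `s`. The piece of highest phase is the first subobject. -/
inductive PhaseFiltered (G : ι → T) (p : ι → ℝ) : ℝ → ObjectProperty T
  | zero (s : ℝ) (X : T) (hX : IsZero X) : PhaseFiltered G p s X
  | cons (s : ℝ) (a : ι) (X X' : T) (f : G a ⟶ X) (g : X ⟶ X') (h : X' ⟶ (G a)⟦(1 : ℤ)⟧)
      (hT : Triangle.mk f g h ∈ distTriang T) (ha : p a ≤ s) (hX' : PhaseFiltered G p (p a) X') :
      PhaseFiltered G p s X

namespace PhaseFiltered

variable {G : ι → T} {p : ι → ℝ}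

theorem mono {s s' : ℝ} (hs : s ≤ s') {X : T} (hX : PhaseFiltered G p s X) :
    PhaseFiltered G p s' X := by
  cases hX with
  | zero _ _ hX => exact zero _ _ hX
  | cons _ a _ X' f g h hT ha hX' => exact cons _ a _ X' f g h hT (ha.trans hs) hX'

theorem of_extensionProduct {s : ℝ} {a : ι} (ha : p a ≤ s) {X : T}
    (hX : (isoClass (G a)).extensionProduct (PhaseFiltered G p (p a)) X) :
    PhaseFiltered G p s X := by
  obtain ⟨Z, f, g, h, hT, hZ⟩ := (extensionProduct_isoClass_iff _ _ _).1 hX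
  exact cons _ a _ Z f g h hT ha hZ

instance (s : ℝ) : (PhaseFiltered G p s).IsClosedUnderIsomorphisms where
  of_iso e hX := by
    cases hX with
    | zero _ _ hX => exact zero _ _ (hX.of_iso e.symm)
    | cons _ a _ X' f g h hT ha hX' =>
      exact of_extensionProduct ha
        (ObjectProperty.prop_of_iso _ e ⟨_, _, f, g, h, hT, ⟨Iso.refl _⟩, hX'⟩)

theorem of_isZero_extension {s : ℝ} {P : ObjectProperty T} (hP : ∀ X, P X → IsZero X) {X : T}
    (hX : P.extensionProduct (PhaseFiltered G p s) X) : PhaseFiltered G p s X := by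
  obtain ⟨Y, Z, f, g, h, hT, hY, hZ⟩ := hX
  have : IsIso g := (Triangle.isZero₁_iff_isIso₂ _ hT).1 (hP _ hY)
  exact ObjectProperty.prop_of_iso _ (asIso g).symm hZ

/-- Sorted filtrations can be kept sorted when a further member of the family is attached from the
left: a piece of low phase moves past the pieces of higher phase because the corresponding extension
splits, unless the two pieces cancel. -/
theorem insert [IsTriangulated T]
    (H : ∀ a b, p a < p b → ∀ f : G b ⟶ (G a)⟦(1 : ℤ)⟧, f = 0 ∨ IsIso f)
    {s : ℝ} {X' : T} (hX' : PhaseFiltered G p s X') {a : ι} (ha : p a ≤ s) {X : T}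
    (hX : (isoClass (G a)).extensionProduct (isoClass X') X) : PhaseFiltered G p s X := by
  induction hX' generalizing X with
  | zero s X' hX' =>
    refine of_extensionProduct ha (ObjectProperty.monotone_extensionProduct_right _ ?_ _ hX)
    rintro Y ⟨e⟩
    exact zero _ _ (hX'.of_iso e)
  | cons s b X' X'' f g h hT hb hX'' ih =>
    rcases le_or_gt (p b) (p a) with hba | hab
    · refine of_extensionProduct ha (ObjectProperty.monotone_extensionProduct_right _ ?_ _ hX)
      rintro Y ⟨e⟩
      exact ObjectProperty.prop_of_iso _ e.symm (cons _ b _ _ f g h hT hba hX'')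
    · have h₁ : (isoClass (G a)).extensionProduct
          ((isoClass (G b)).extensionProduct (isoClass X'')) X := by
        refine ObjectProperty.monotone_extensionProduct_right _ ?_ _ hX
        rintro Y ⟨e⟩
        exact ObjectProperty.prop_of_iso _ e.symm
          ⟨_, _, f, g, h, hT, ⟨Iso.refl _⟩, ⟨Iso.refl _⟩⟩
      rw [← ObjectProperty.extensionProduct_assoc] at h₁
      obtain ⟨Y, Z, f', g', h', hT', hY, ⟨e⟩⟩ := h₁
      have hZ : PhaseFiltered G p (p b) Z := ObjectProperty.prop_of_iso _ e.symm hX''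
      rcases isZero_or_extensionProduct_swap (H a b hab) hY with h0 | hY'
      · exact (of_isZero_extension (P := isoClass Y) (fun W ⟨e⟩ => h0.of_iso e)
          ⟨_, _, f', g', h', hT', ⟨Iso.refl _⟩, hZ⟩).mono hb
      · have h₂ : ((isoClass (G b)).extensionProduct (isoClass (G a))).extensionProduct
            (isoClass X'') X := ⟨_, _, f', g', h', hT', hY', ⟨e⟩⟩
        rw [ObjectProperty.extensionProduct_assoc] at h₂
        exact of_extensionProduct hb
          (ObjectProperty.monotone_extensionProduct_right _ (fun W hW => ih hab.le hW) _ h₂)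

theorem extension [IsTriangulated T]
    (H : ∀ a b, p a < p b → ∀ f : G b ⟶ (G a)⟦(1 : ℤ)⟧, f = 0 ∨ IsIso f)
    {s : ℝ} {X₁ X₂ X : T} (h₁ : PhaseFiltered G p s X₁) (h₂ : PhaseFiltered G p s X₂)
    (hX : (isoClass X₁).extensionProduct (isoClass X₂) X) : PhaseFiltered G p s X := by
  suffices h : ∀ t, s ≤ t → PhaseFiltered G p t X₂ → PhaseFiltered G p t X from h s le_rfl h₂
  clear h₂
  intro t hst h₂
  have mem_isoClass : ∀ {s : ℝ} {A : T}, PhaseFiltered G p s A →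
      isoClass A ≤ PhaseFiltered G p s := by
    rintro s A hA Y ⟨e⟩
    exact ObjectProperty.prop_of_iso _ e.symm hA
  induction h₁ generalizing X with
  | zero s X₁ hX₁ =>
    exact of_isZero_extension (P := isoClass X₁) (fun W ⟨e⟩ => hX₁.of_iso e)
      (ObjectProperty.monotone_extensionProduct_right _ (mem_isoClass h₂) _ hX)
  | cons s a X₁ X₁' f g h hT ha _ ih =>
    have h₃ : ((isoClass (G a)).extensionProduct (isoClass X₁')).extensionProduct
        (isoClass X₂) X := by
      refine ObjectProperty.monotone_extensionProduct_left _ ?_ _ hX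
      rintro Y ⟨e⟩
      exact ObjectProperty.prop_of_iso _ e.symm ⟨_, _, f, g, h, hT, ⟨Iso.refl _⟩, ⟨Iso.refl _⟩⟩
    rw [ObjectProperty.extensionProduct_assoc] at h₃
    obtain ⟨Z, f', g', h', hT', hZ⟩ := (extensionProduct_isoClass_iff _ _ _).1 h₃
    exact insert H (ih hZ (ha.trans hst)) (ha.trans hst)
      ⟨_, _, f', g', h', hT', ⟨Iso.refl _⟩, ⟨Iso.refl _⟩⟩

theorem shift {s : ℝ} {X : T} (hX : PhaseFiltered G p s X) (k : ℤ)
    (hG : ∀ a, ∃ b, p b = p a + k ∧ Nonempty ((G a)⟦k⟧ ≅ G b)) :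
    PhaseFiltered G p (s + k) (X⟦k⟧) := by
  induction hX with
  | zero s X hX => exact zero _ _ ((shiftFunctor T k).map_isZero hX)
  | cons s a X X' f g h hT ha _ ih =>
    obtain ⟨b, hb, ⟨e⟩⟩ := hG a
    refine of_extensionProduct (a := b) (by linarith) ?_
    rw [hb]
    exact ⟨_, _, _, _, _, Triangle.shift_distinguished _ hT k, ⟨e⟩, ih⟩

/-- The objects with a sorted filtration form a strictly full triangulated subcategory. -/
theorem exists_of_triangulatedSpan_eq_top [IsTriangulated T]
    (H : ∀ a b, p a < p b → ∀ f : G b ⟶ (G a)⟦(1 : ℤ)⟧, f = 0 ∨ IsIso f)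
    (hG : ∀ (k : ℤ) a, ∃ b, p b = p a + k ∧ Nonempty ((G a)⟦k⟧ ≅ G b))
    {S : Set T} (hS : ∀ X ∈ S, ∃ a, Nonempty (X ≅ G a)) (hfull : triangulatedSpan S = ⊤) (X : T) :
    ∃ s, PhaseFiltered G p s X := by
  let D : ObjectProperty T := fun X => ∃ s, PhaseFiltered G p s X
  have hiso : D.IsClosedUnderIsomorphisms :=
    ⟨fun e ⟨s, hs⟩ => ⟨s, ObjectProperty.prop_of_iso _ e hs⟩⟩
  have hzero : D.ContainsZero := ⟨⟨0, isZero_zero T, 0, zero _ _ (isZero_zero T)⟩⟩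
  have hshift : D.IsStableUnderShift ℤ := ⟨fun k => ⟨fun X ⟨s, hs⟩ => ⟨s + k, hs.shift k (hG k)⟩⟩⟩
  have hext : D.IsTriangulatedClosed₂ := .mk' fun Δ hΔ ⟨s₁, h₁⟩ ⟨s₃, h₃⟩ =>
    ⟨max s₁ s₃, extension H (h₁.mono (le_max_left _ _)) (h₃.mono (le_max_right _ _))
      ⟨_, _, Δ.mor₁, Δ.mor₂, Δ.mor₃, hΔ, ⟨Iso.refl _⟩, ⟨Iso.refl _⟩⟩⟩
  have htop : triangulatedSpan S X := by rw [hfull]; trivial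
  refine htop D .mk hiso fun Y hY => ?_
  obtain ⟨a, ⟨e⟩⟩ := hS Y hY
  refine ⟨p a, of_extensionProduct le_rfl
    (ObjectProperty.prop_of_iso _ e.symm ⟨_, _, _, _, _, contractible_distinguished _,
      ⟨Iso.refl _⟩, zero _ _ (isZero_zero T)⟩)⟩

/-- The part of phase exactly `s` of an object whose pieces have phases at most `s`. -/
theorem exists_top_part [IsTriangulated T] {s : ℝ} {X : T} (hX : PhaseFiltered G p s X) :
    ∃ (A R : T) (f : A ⟶ X) (g : X ⟶ R) (h : R ⟶ A⟦(1 : ℤ)⟧),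
      Triangle.mk f g h ∈ distTriang T ∧ ExtensionClosure {B | ∃ a, p a = s ∧ B = G a} A ∧
      ∃ s' < s, PhaseFiltered G p s' R := by
  have htriv : ∀ {s s' : ℝ} {X : T}, PhaseFiltered G p s' X → s' < s →
    ∃ (A R : T) (f : A ⟶ X) (g : X ⟶ R) (h : R ⟶ A⟦(1 : ℤ)⟧),
      Triangle.mk f g h ∈ distTriang T ∧ ExtensionClosure {B | ∃ a, p a = s ∧ B = G a} A ∧
      ∃ s' < s, PhaseFiltered G p s' R := fun {s s' X} h hs =>
    ⟨0, X, 0, 𝟙 X, 0, (Triangle.distinguished_iff_of_isZero₁ _ (isZero_zero T)).2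
      (inferInstanceAs (IsIso (𝟙 X))), .zero _ (isZero_zero T), s', hs, h⟩
  induction hX with
  | zero s X hX => exact htriv (zero (s - 1) X hX) (by linarith)
  | cons s a X X' f g h hT ha hX' ih =>
    rcases ha.lt_or_eq with hlt | rfl
    · exact htriv (cons _ a _ _ f g h hT le_rfl hX') hlt
    · obtain ⟨A', R, f', g', h', hT', hA', hR⟩ := ih
      have hprod : (isoClass (G a)).extensionProduct
          ((isoClass A').extensionProduct (isoClass R)) X :=
        ⟨_, _, f, g, h, hT, ⟨Iso.refl _⟩, ⟨_, _, f', g', h', hT', ⟨Iso.refl _⟩, ⟨Iso.refl _⟩⟩⟩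
      rw [← ObjectProperty.extensionProduct_assoc] at hprod
      obtain ⟨A, R', f'', g'', h'', hT'', hA, ⟨e⟩⟩ := hprod
      obtain ⟨s', hs', hR⟩ := hR
      refine ⟨A, R', f'', g'', h'', hT'', ?_, s', hs', ObjectProperty.prop_of_iso _ e.symm hR⟩
      obtain ⟨Y, Z, u, v, w, hT₃, ⟨e₁⟩, ⟨e₂⟩⟩ := hA
      exact .ext _ hT₃ (.of_iso e₁.symm (.of _ ⟨a, rfl, rfl⟩)) (.of_iso e₂.symm hA')

end PhaseFiltered

/-! ### Semistable objects -/

namespace Slicing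

variable (σ : Slicing T) {G : ι → T} {p : ι → ℝ}

theorem shift_int_iff (φ : ℝ) (X : T) (j : ℤ) : σ.P (φ + j) (X⟦j⟧) ↔ σ.P φ X := by
  have := σ.closedUnderIso
  have hstep (j : ℤ) : σ.P (φ + (j + 1 : ℤ)) (X⟦j + 1⟧) ↔ σ.P (φ + j) (X⟦j⟧) := by
    rw [← σ.shift_iff (φ + j), (σ.P _).prop_iff_of_iso ((shiftFunctorAdd T j 1).app X),
      Int.cast_add, Int.cast_one, ← add_assoc]
    rfl
  induction j using Int.induction_on with
  | zero =>
    rw [Int.cast_zero, add_zero]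
    exact (σ.P _).prop_iff_of_iso ((shiftFunctorZero T ℤ).app X)
  | succ j ih => exact (hstep j).trans ih
  | pred j ih =>
    have h := hstep (-j - 1)
    rw [sub_add_cancel] at h
    exact h.symm.trans ih

theorem hom_eq_zero_of_phaseFiltered (hG : ∀ a, σ.P (p a) (G a)) {s t : ℝ} (hst : s < t) {X Y : T}
    (hX : σ.P t X) (hY : PhaseFiltered G p s Y) (f : X ⟶ Y) : f = 0 := by
  induction hY with
  | zero s Y hY => exact hY.eq_of_tgt _ _
  | cons s a Y Y' u v w hT ha _ ih =>
    obtain ⟨k, rfl⟩ := Triangle.coyoneda_exact₂ _ hT f (ih (ha.trans_lt hst) _)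
    exact (congrArg (· ≫ _) (σ.hom_eq_zero (ha.trans_lt hst) hX (hG a) k)).trans zero_comp

/-- An object of `P(t)` that has a sorted filtration by semistable objects `G a` of phases `p a` is
an iterated extension of those `G a` whose phase is `t`. -/
theorem extensionClosure_of_phaseFiltered [IsTriangulated T] (hG : ∀ a, σ.P (p a) (G a))
    (hG0 : ∀ a, ¬ IsZero (G a)) {s t : ℝ} {X : T} (hX : PhaseFiltered G p s X) (hXt : σ.P t X) :
    ExtensionClosure {B | ∃ a, p a = t ∧ B = G a} X := by
  cases hX with
  | zero _ _ hX => exact .zero _ hX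
  | cons _ a _ X' f g h hT ha hX' =>
    have hX : PhaseFiltered G p (p a) X := .cons _ a _ X' f g h hT le_rfl hX'
    rcases lt_trichotomy (p a) t with hlt | rfl | hgt
    · exact .zero _ ((IsZero.iff_id_eq_zero X).2
        (σ.hom_eq_zero_of_phaseFiltered hG hlt hXt hX (𝟙 X)))
    · obtain ⟨A, R, f', g', h', hT', hA, s', hs', hR⟩ := hX.exists_top_part
      have hg : g' = 0 := σ.hom_eq_zero_of_phaseFiltered hG hs' hXt hR g'
      -- As `X ⟶ R` vanishes, `R` is a direct summand of `A⟦1⟧`, whose phase is larger.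
      have hAP : ∀ (B : T), ExtensionClosure {B | ∃ b, p b = p a ∧ B = G b} B →
          ∀ k : B⟦(1 : ℤ)⟧ ⟶ R, k = 0 := by
        intro B hB
        induction hB with
        | zero B hB => exact fun k => ((shiftFunctor T (1 : ℤ)).map_isZero hB).eq_of_src _ _
        | of B hB =>
          obtain ⟨b, hb, rfl⟩ := hB
          exact σ.hom_eq_zero_of_phaseFiltered hG (by rw [← hb] at hs'; linarith)
            ((σ.shift_iff _ _).2 (hG b)) hR
        | ext Δ hΔ _ _ h₁ h₃ =>
          intro k
          obtain ⟨l, rfl⟩ :=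
            Triangle.yoneda_exact₂ _ (Triangle.shift_distinguished Δ hΔ 1) k (h₁ _)
          exact (congrArg (_ ≫ ·) (h₃ l)).trans comp_zero
      have hR0 : IsZero R := by
        rw [IsZero.iff_id_eq_zero]
        obtain ⟨k, hk⟩ := Triangle.yoneda_exact₃ _ hT' (𝟙 R)
          ((Category.comp_id g').trans hg)
        exact hk.trans ((congrArg (_ ≫ ·) (hAP A hA k)).trans comp_zero)
      have : IsIso f' := (Triangle.isZero₃_iff_isIso₁ _ hT').1 hR0
      exact hA.of_iso (asIso f')
    · -- As `G a ⟶ X` vanishes, `(G a)⟦1⟧` is a direct summand of `X'`, whose pieces have phases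
      -- at most `p a`.
      have hf : f = 0 := σ.hom_eq_zero hgt (hG a) hXt f
      have hGa : IsZero ((G a)⟦(1 : ℤ)⟧) := by
        rw [IsZero.iff_id_eq_zero]
        obtain ⟨k, hk⟩ := Triangle.coyoneda_exact₁ _ hT (𝟙 ((G a)⟦(1 : ℤ)⟧))
          ((Category.id_comp _).trans (by
            change f⟦(1 : ℤ)⟧' = 0
            rw [hf, Functor.map_zero]))
        exact hk.trans ((congrArg (· ≫ _) (σ.hom_eq_zero_of_phaseFiltered hG (lt_add_one (p a))
          ((σ.shift_iff _ _).2 (hG a)) hX' k)).trans zero_comp)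
      refine absurd ?_ (hG0 a)
      exact ((shiftFunctor T (-1 : ℤ)).map_isZero hGa).of_iso (shiftShiftNeg (G a) (1 : ℤ)).symm

end Slicing

end Triangulated

/-! ### Exceptional objects and fully faithful functors -/

section Exceptional

variable {T : Type u} [Category.{v} T] [HasShift T ℤ]

theorem IsShiftOf.trans {X Y Z : T} : IsShiftOf X Y → IsShiftOf Y Z → IsShiftOf X Z :=
  fun ⟨k, ⟨e⟩⟩ ⟨m, ⟨e'⟩⟩ =>
    ⟨m + k, ⟨e ≪≫ (shiftFunctor T k).mapIso e' ≪≫ ((shiftFunctorAdd T m k).app Z).symm⟩⟩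

theorem IsShiftOf.map {D : Type*} [Category* D] [HasShift D ℤ] (F : D ⥤ T) [F.CommShift ℤ]
    {X Y : D} : IsShiftOf X Y → IsShiftOf (F.obj X) (F.obj Y) :=
  fun ⟨k, ⟨e⟩⟩ => ⟨k, ⟨F.mapIso e ≪≫ (F.commShiftIso k).app Y⟩⟩

theorem IsShiftOf.of_map {D : Type*} [Category* D] [HasShift D ℤ] (F : D ⥤ T) [F.CommShift ℤ]
    [F.Full] [F.Faithful] {X Y : D} : IsShiftOf (F.obj X) (F.obj Y) → IsShiftOf X Y :=
  fun ⟨k, ⟨e⟩⟩ => ⟨k, ⟨F.preimageIso (e ≪≫ ((F.commShiftIso k).app Y).symm)⟩⟩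

variable [Preadditive T]

theorem hom_shift_eq_zero [∀ n : ℤ, (shiftFunctor T n).Additive] {X Y : T} {k a b : ℤ}
    (hk : k + a = b) (H : ∀ f : X ⟶ Y⟦k⟧, f = 0)
    (f : X⟦a⟧ ⟶ Y⟦b⟧) : f = 0 := by
  obtain ⟨g, hg⟩ := (shiftFunctor T a).map_surjective
    (f ≫ ((shiftFunctorAdd' T k a b hk).app Y).hom)
  rw [H g, Functor.map_zero] at hg
  rw [← cancel_mono ((shiftFunctorAdd' T k a b hk).app Y).hom, ← hg, zero_comp]

theorem hom_shift_shift_eq_zero [∀ n : ℤ, (shiftFunctor T n).Additive] {X Y : T}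
    {k a b c : ℤ} (hk : k + a = b + c) (H : ∀ f : X ⟶ Y⟦k⟧, f = 0)
    (f : X⟦a⟧ ⟶ Y⟦b⟧⟦c⟧) : f = 0 := by
  rw [← cancel_mono ((shiftFunctorAdd T b c).app Y).inv, zero_comp]
  exact hom_shift_eq_zero hk H _

theorem exists_hom_shift_zero_ne_zero {X Y : T} {f : X ⟶ Y} (hf : f ≠ 0) :
    ∃ g : X ⟶ Y⟦(0 : ℤ)⟧, g ≠ 0 :=
  ⟨f ≫ (shiftFunctorZero T ℤ).inv.app Y, fun h => hf (zero_of_comp_mono _ h)⟩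

theorem exists_hom_ne_zero_of_map {D : Type*} [Category* D] [HasShift D ℤ] [Preadditive D]
    (F : D ⥤ T) [F.CommShift ℤ] [F.Full] [F.Additive] {X Y : D} {k : ℤ}
    {f : F.obj X ⟶ (F.obj Y)⟦k⟧} (hf : f ≠ 0) : ∃ g : X ⟶ Y⟦k⟧, g ≠ 0 := by
  obtain ⟨g, hg⟩ := F.map_surjective (f ≫ (F.commShiftIso k).inv.app Y)
  refine ⟨g, ?_⟩
  rintro rfl
  rw [F.map_zero] at hg
  exact hf (zero_of_comp_mono _ hg.symm)

variable {K : Type w} [Field K] [Linear K T]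

namespace IsExceptionalObject

theorem eq_zero_or_isIso {E : T} (hE : IsExceptionalObject K E) (f : E ⟶ E) :
    f = 0 ∨ IsIso f := by
  obtain ⟨c, rfl⟩ := hE.end_eq.2 f
  rcases eq_or_ne c 0 with rfl | hc
  · exact .inl (zero_smul _ _)
  · exact .inr ⟨c⁻¹ • 𝟙 E, by simp [smul_smul, hc], by simp [smul_smul, hc]⟩

/-- Exceptional objects are indecomposable. -/
theorem nonempty_iso_of_retract {E X : T} (hX : IsExceptionalObject K X) (hE : ¬ IsZero E)
    (r : Retract E X) : Nonempty (X ≅ E) := by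
  rcases hX.eq_zero_or_isIso (r.r ≫ r.i) with h | h
  · refine absurd ((IsZero.iff_id_eq_zero E).2 ?_) hE
    have h' := congrArg (fun f => r.i ≫ f ≫ r.r) h
    simpa using h'
  · have : Mono r.r := mono_of_mono r.r r.i
    have : IsIso r.r := isIso_of_mono_of_isSplitEpi r.r
    exact ⟨asIso r.r⟩

theorem map {D : Type*} [Category* D] [HasShift D ℤ] [Preadditive D] [Linear K D] (F : D ⥤ T)
    [F.CommShift ℤ] [F.Full] [F.Faithful] [F.Additive] [F.Linear K] {E : D}
    (hE : IsExceptionalObject K E) : IsExceptionalObject K (F.obj E) where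
  end_eq := by
    have h : (fun c : K => c • 𝟙 (F.obj E)) = fun c => F.map (c • 𝟙 E) := by
      ext c
      rw [F.map_smul, F.map_id]
    rw [h]
    exact ((Functor.FullyFaithful.ofFullyFaithful F).map_bijective E E).comp hE.end_eq
  hom_eq_zero k hk f := by
    obtain ⟨g, hg⟩ := F.map_surjective (f ≫ ((F.commShiftIso k).app E).inv)
    rw [hE.hom_eq_zero k hk g, F.map_zero] at hg
    rw [← cancel_mono ((F.commShiftIso k).app E).inv, ← hg, zero_comp]

theorem of_map {D : Type*} [Category* D] [HasShift D ℤ] [Preadditive D] [Linear K D] (F : D ⥤ T)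
    [F.CommShift ℤ] [F.Full] [F.Faithful] [F.Additive] [F.Linear K] {E : D}
    (hE : IsExceptionalObject K (F.obj E)) : IsExceptionalObject K E where
  end_eq := by
    refine ((Functor.FullyFaithful.ofFullyFaithful F).map_bijective E E).of_comp_iff' _ |>.1 ?_
    convert hE.end_eq using 1
    ext c
    rw [Function.comp_apply, F.map_smul, F.map_id]
  hom_eq_zero k hk f := by
    refine F.map_injective ?_
    rw [← cancel_mono ((F.commShiftIso k).hom.app E), F.map_zero, zero_comp]
    exact hE.hom_eq_zero k hk _

end IsExceptionalObject

end Exceptional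

/-! ### The semistable objects of a σ-exceptional collection -/

section Collection

variable {K : Type w} [Field K] {T : Type u} [Category.{v} T] [HasZeroObject T]
  [HasShift T ℤ] [Preadditive T] [Linear K T] [∀ m : ℤ, (shiftFunctor T m).Additive]
  [Pretriangulated T]

theorem StabilityCondition.IsSemistable.prop_phase {σ : StabilityCondition T} {A : T}
    (hA : σ.IsSemistable A) : σ.P (σ.phase A) A := by
  obtain ⟨t, ht⟩ := hA.2
  rwa [σ.phase_eq ht hA.1]

variable {σ : StabilityCondition T} {n : ℕ} {E : Fin (n + 1) → T}

omit [Pretriangulated T] in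
/-- A non-zero morphism of some degree between members of an exceptional collection, up to shifts,
cannot go from a member to an earlier one. -/
theorem IsExceptionalCollection.le_of_hom_ne_zero (hE : IsExceptionalCollection K E)
    {X Y : T} {i j : Fin (n + 1)} (hX : IsShiftOf X (E i)) (hY : IsShiftOf Y (E j)) {k : ℤ}
    {f : X ⟶ Y⟦k⟧} (hf : f ≠ 0) : i ≤ j := by
  obtain ⟨a, ⟨e⟩⟩ := hX
  obtain ⟨b, ⟨e'⟩⟩ := hY
  by_contra! hlt
  refine hf ?_
  rw [← cancel_epi e.inv, ← cancel_mono (e'.hom⟦k⟧'), comp_zero, zero_comp]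
  exact hom_shift_shift_eq_zero (k := b + k - a) (by ring) (hE.hom_eq_zero i j hlt _) _

namespace IsSigmaExceptionalCollection

/-- The phases of the members of a `σ`-exceptional collection differ by less than `1`. -/
theorem phase_lt_phase_add_one (hσ : IsSigmaExceptionalCollection K σ E) (i j : Fin (n + 1)) :
    σ.phase (E i) < σ.phase (E j) + 1 := by
  obtain ⟨t, ht⟩ := hσ.exists_phase_mem
  linarith [(ht i).2, (ht j).1]

/-- Degree one morphisms from a shifted member of higher phase to a shifted member of lower phase
vanish, unless both are shifts of the same member and the morphism is invertible. -/
theorem eq_zero_or_isIso (hσ : IsSigmaExceptionalCollection K σ E)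
    (hphase : StrictMono fun i => σ.phase (E i)) (a b : Fin (n + 1) × ℤ)
    (hab : σ.phase (E a.1) + a.2 < σ.phase (E b.1) + b.2)
    (f : (E b.1)⟦b.2⟧ ⟶ (E a.1)⟦a.2⟧⟦(1 : ℤ)⟧) : f = 0 ∨ IsIso f := by
  obtain ⟨i, j⟩ := a
  obtain ⟨i', j'⟩ := b
  dsimp only at hab f ⊢
  have hle : j ≤ j' := by
    have h := hσ.phase_lt_phase_add_one i' i
    have : (j : ℝ) < (j' + 1 : ℤ) := by push_cast; linarith
    exact Int.lt_add_one_iff.1 (by exact_mod_cast this)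
  rcases hle.eq_or_lt with rfl | hlt
  · have hi : i < i' := hphase.lt_iff_lt.1 (by simpa using hab)
    exact .inl (hom_shift_shift_eq_zero (k := 1) (by ring) (hσ.hom_eq_zero i' i hi 1) f)
  · rcases eq_or_ne i' i with rfl | hne
    · rcases eq_or_ne j' (j + 1) with rfl | hj
      · -- Here `f` is, up to isomorphism, a shifted endomorphism of `E i`.
        let e := (shiftFunctorAdd T j 1).app (E i')
        obtain ⟨g, hg⟩ := (shiftFunctor T (j + 1)).map_surjective (f ≫ e.inv)
        have hf : f = g⟦j + 1⟧' ≫ e.hom := by rw [hg]; exact (e.comp_inv_eq.1 rfl)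
        rcases (hσ.exceptional i').eq_zero_or_isIso g with rfl | hg'
        · exact .inl (by rw [hf, Functor.map_zero, zero_comp])
        · exact .inr (by rw [hf]; infer_instance)
      · exact .inl (hom_shift_shift_eq_zero (k := j + 1 - j') (by ring)
          ((hσ.exceptional i').hom_eq_zero _ (by omega)) f)
    · exact .inl (hom_shift_shift_eq_zero (k := j + 1 - j') (by ring)
        (hσ.ext_exceptional i' i hne _ (by omega)) f)

theorem phase_add_injective (hσ : IsSigmaExceptionalCollection K σ E)
    (hphase : StrictMono fun i => σ.phase (E i)) {i i' : Fin (n + 1)} {j j' : ℤ}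
    (h : σ.phase (E i) + j = σ.phase (E i') + j') : i = i' ∧ j = j' := by
  have h₁ := hσ.phase_lt_phase_add_one i i'
  have h₂ := hσ.phase_lt_phase_add_one i' i
  have h₃ : (j : ℝ) < (j' + 1 : ℤ) := by push_cast; linarith
  have h₄ : (j' : ℝ) < (j + 1 : ℤ) := by push_cast; linarith
  have hj : j = j' := by
    have h₅ : j < j' + 1 := by exact_mod_cast h₃
    have h₆ : j' < j + 1 := by exact_mod_cast h₄
    omega
  subst hj
  exact ⟨hphase.injective (by simpa using h), rfl⟩

variable [IsTriangulated T]

/-- Every object of `P(t)` is an iterated extension of the shifted members of phase `t`. -/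
theorem extensionClosure_of_prop (hσ : IsSigmaExceptionalCollection K σ E)
    (hfull : IsFullExceptionalCollection K E) (hphase : StrictMono fun i => σ.phase (E i))
    {t : ℝ} {X : T} (hX : σ.P t X) :
    ExtensionClosure {B | ∃ a : Fin (n + 1) × ℤ, σ.phase (E a.1) + a.2 = t ∧ B = (E a.1)⟦a.2⟧}
      X := by
  obtain ⟨s, hs⟩ := PhaseFiltered.exists_of_triangulatedSpan_eq_top
    (G := fun a : Fin (n + 1) × ℤ => (E a.1)⟦a.2⟧) (p := fun a => σ.phase (E a.1) + a.2)
    (hσ.eq_zero_or_isIso hphase)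
    (fun k (a : Fin (n + 1) × ℤ) => ⟨(a.1, a.2 + k), by push_cast; ring,
      ⟨((shiftFunctorAdd T a.2 k).app (E a.1)).symm⟩⟩)
    (by
      rintro _ ⟨i, rfl⟩
      exact ⟨(i, 0), ⟨((shiftFunctorZero T ℤ).app (E i)).symm⟩⟩) hfull.full X
  refine σ.extensionClosure_of_phaseFiltered (G := fun a : Fin (n + 1) × ℤ => (E a.1)⟦a.2⟧)
    (fun a => (σ.shift_int_iff _ _ a.2).2 (hσ.semistable a.1).prop_phase) (fun a h0 => ?_) hs hX
  exact (hσ.semistable a.1).1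
    (((shiftFunctor T (-a.2)).map_isZero h0).of_iso (shiftShiftNeg (E a.1) a.2).symm)

theorem extensionClosure_singleton_of_prop (hσ : IsSigmaExceptionalCollection K σ E)
    (hfull : IsFullExceptionalCollection K E) (hphase : StrictMono fun i => σ.phase (E i))
    {i : Fin (n + 1)} {j : ℤ} {X : T} (hX : σ.P (σ.phase (E i) + j) X) :
    ExtensionClosure {(E i)⟦j⟧} X := by
  have h := hσ.extensionClosure_of_prop hfull hphase hX
  convert h using 1
  ext B
  constructor
  · intro hB
    exact ⟨(i, j), rfl, hB⟩
  · rintro ⟨⟨i', j'⟩, h, rfl⟩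
    obtain ⟨rfl, rfl⟩ := hσ.phase_add_injective hphase h
    rfl

theorem prop_eq_shiftedExtensionClosure (hσ : IsSigmaExceptionalCollection K σ E)
    (hfull : IsFullExceptionalCollection K E) (hphase : StrictMono fun i => σ.phase (E i))
    (i : Fin (n + 1)) (j : ℤ) :
    σ.P (σ.phase (E i) + j) = shiftedExtensionClosure (E i) j := by
  have := σ.closedUnderIso
  have := σ.additive
  refine le_antisymm (fun X hX => shiftedExtensionClosure_of_extensionClosure
    (hσ.extensionClosure_singleton_of_prop hfull hphase hX)) ?_
  rintro X ⟨Y, hY, ⟨e⟩⟩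
  refine (σ.P _).prop_of_iso e.symm ((σ.shift_int_iff _ _ _).2 ?_)
  exact hY.prop_of_isClosedUnderFiniteProducts
    ((hσ.exceptional i).hom_eq_zero 1 one_ne_zero) _ (hσ.semistable i).prop_phase

theorem exists_eq_phase_add (hσ : IsSigmaExceptionalCollection K σ E)
    (hfull : IsFullExceptionalCollection K E) (hphase : StrictMono fun i => σ.phase (E i))
    {t : ℝ} {X : T} (hX : σ.P t X) (h0 : ¬ IsZero X) :
    ∃ (i : Fin (n + 1)) (j : ℤ), t = σ.phase (E i) + j := by
  by_contra! h
  refine h0 (ExtensionClosure.isZero_of_empty ?_)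
  have h' := hσ.extensionClosure_of_prop hfull hphase hX
  convert h' using 1
  ext B
  constructor
  · exact fun hB => hB.elim
  · rintro ⟨a, ha, -⟩
    exact h a.1 a.2 ha.symm

/-- The members of the collection are the only semistable exceptional objects, up to shifts. -/
theorem exists_isShiftOf (hσ : IsSigmaExceptionalCollection K σ E)
    (hfull : IsFullExceptionalCollection K E) (hphase : StrictMono fun i => σ.phase (E i))
    {X : T} (hX : IsExceptionalObject K X) (hss : σ.IsSemistable X) : ∃ i, IsShiftOf X (E i) := by
  obtain ⟨h0, t, ht⟩ := hss
  obtain ⟨i, j, rfl⟩ := hσ.exists_eq_phase_add hfull hphase ht h0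
  obtain ⟨r⟩ := (hσ.extensionClosure_singleton_of_prop hfull hphase ht).nonempty_retract
    (hom_shift_shift_eq_zero (k := 1) (by ring) ((hσ.exceptional i).hom_eq_zero 1 one_ne_zero)) h0
  refine ⟨i, j, hX.nonempty_iso_of_retract (fun h => (hσ.semistable i).1 ?_) r⟩
  exact ((shiftFunctor T (-j)).map_isZero h).of_iso (shiftShiftNeg (E i) j).symm

theorem stableDerivedPoints_eq (hσ : IsSigmaExceptionalCollection K σ E)
    (hfull : IsFullExceptionalCollection K E) (hphase : StrictMono fun i => σ.phase (E i)) :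
    stableDerivedPoints K σ = Set.range fun i => triangulatedSpan {E i} := by
  ext A
  constructor
  · rintro ⟨-, X, hX, rfl, hss⟩
    obtain ⟨i, hi⟩ := hσ.exists_isShiftOf hfull hphase hX hss
    exact ⟨i, (triangulatedSpan_singleton_eq_of_isShiftOf hi).symm⟩
  · rintro ⟨i, rfl⟩
    exact ⟨⟨E i, hσ.exceptional i, rfl⟩, E i, hσ.exceptional i, rfl, hσ.semistable i⟩

/-- Only finitely many members of a set of exceptional objects, no two of which are shifts of each
other, can become semistable under a fully faithful functor. -/
theorem finite_semistable_image (hσ : IsSigmaExceptionalCollection K σ E)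
    (hfull : IsFullExceptionalCollection K E) (hphase : StrictMono fun i => σ.phase (E i))
    {D : Type*} [Category* D] [HasShift D ℤ] [Preadditive D] [Linear K D] (F : D ⥤ T)
    [F.CommShift ℤ] [F.Full] [F.Faithful] [F.Additive] [F.Linear K] {𝓔 : Set D}
    (h𝓔 : IsExceptionalTransversal K 𝓔) :
    {X | X ∈ 𝓔 ∧ σ.IsSemistable (F.obj X)}.Finite := by
  have h (X : D) (hX : X ∈ {X | X ∈ 𝓔 ∧ σ.IsSemistable (F.obj X)}) :
      ∃ i, IsShiftOf (F.obj X) (E i) :=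
    hσ.exists_isShiftOf hfull hphase ((h𝓔.exceptional X hX.1).map F) hX.2
  choose! i hi using h
  refine Set.Finite.of_injOn (f := i) (t := Set.univ) (fun _ _ => trivial) ?_ Set.finite_univ
  intro X hX Y hY hXY
  have hs : IsShiftOf X Y := .of_map F ((hi X hX).trans (hXY ▸ (hi Y hY).symm))
  exact (h𝓔.existsUnique X (h𝓔.exceptional X hX.1)).unique
    ⟨hX.1, ⟨0, ⟨((shiftFunctorZero D ℤ).app X).symm⟩⟩⟩ ⟨hY.1, hs⟩

/-- A cycle of three exceptional objects with non-zero morphisms of some degrees between consecutive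
ones, not all of them shifts of each other, cannot have semistable images: up to shifts these images
would be members of the collection with cyclically increasing indices. -/
theorem not_forall_semistable (hσ : IsSigmaExceptionalCollection K σ E)
    (hfull : IsFullExceptionalCollection K E) (hphase : StrictMono fun i => σ.phase (E i))
    {D : Type*} [Category* D] [HasShift D ℤ] [Preadditive D] [Linear K D] (F : D ⥤ T)
    [F.CommShift ℤ] [F.Full] [F.Faithful] [F.Additive] [F.Linear K] {𝓔 : Set D}
    (h𝓔 : IsExceptionalTransversal K 𝓔) {X Y Z : D} (hX : IsExceptionalObject K X)
    (hY : IsExceptionalObject K Y) (hZ : IsExceptionalObject K Z) {a b c : ℤ} {f : X ⟶ Y⟦a⟧}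
    {g : Y ⟶ Z⟦b⟧} {h : Z ⟶ X⟦c⟧} (hf : f ≠ 0) (hg : g ≠ 0) (hh : h ≠ 0)
    (hXZ : ¬ IsShiftOf Z X) : ¬ ∀ A ∈ 𝓔, σ.IsSemistable (F.obj A) := by
  intro hss
  have hshift {A : D} (hA : IsExceptionalObject K A) : ∃ i, IsShiftOf (F.obj A) (E i) := by
    obtain ⟨B, ⟨hB, hAB⟩, -⟩ := h𝓔.existsUnique A hA
    obtain ⟨i, hi⟩ := hσ.exists_isShiftOf hfull hphase ((h𝓔.exceptional B hB).map F) (hss B hB)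
    exact ⟨i, (hAB.map F).trans hi⟩
  have hne {A B : D} {k : ℤ} {q : A ⟶ B⟦k⟧} (hq : q ≠ 0) :
      F.map q ≫ (F.commShiftIso k).hom.app B ≠ 0 := by
    intro h0
    refine hq (F.map_injective ?_)
    rw [← cancel_mono ((F.commShiftIso k).hom.app B), h0, F.map_zero, zero_comp]
  obtain ⟨i, hi⟩ := hshift hX
  obtain ⟨j, hj⟩ := hshift hY
  obtain ⟨k, hk⟩ := hshift hZ
  have hij := hfull.le_of_hom_ne_zero hi hj (hne hf)
  have hjk := hfull.le_of_hom_ne_zero hj hk (hne hg)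
  have hki := hfull.le_of_hom_ne_zero hk hi (hne hh)
  obtain rfl : k = i := le_antisymm hki (hij.trans hjk)
  exact hXZ (.of_map F (hk.trans hi.symm))

end IsSigmaExceptionalCollection

end Collection

/-! ### Projective, injective objects and extensions in the bounded derived category -/

section DerivedCategory

open DerivedCategory

universe w'

variable {K : Type w} [Field K] {C : Type u} [Category.{v} C] [Abelian C] [Linear K C]
  [HasDerivedCategory.{w'} C]

theorem singleFunctor_hom_eq_zero_of_neg (X Y : C) {k : ℤ} (hk : k < 0)
    (f : (singleFunctor C 0).obj X ⟶ ((singleFunctor C 0).obj Y)⟦k⟧) : f = 0 := by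
  have : TStructure.t.IsGE (((singleFunctor C 0).obj Y)⟦k⟧) (-k) :=
    TStructure.t.isGE_shift _ 0 k (-k) (by omega)
  exact TStructure.t.zero f 0 (-k) (by omega)

theorem singleFunctor_hom_eq_zero_of_projective (X Y : C) [Projective X] {k : ℤ} (hk : 0 < k)
    (f : (singleFunctor C 0).obj X ⟶ ((singleFunctor C 0).obj Y)⟦k⟧) : f = 0 := by
  have : HasExt.{max u v} C := HasExt.standard C
  obtain ⟨n, rfl⟩ : ∃ n : ℕ, k = (n + 1 : ℕ) := ⟨k.toNat - 1, by omega⟩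
  obtain ⟨e, rfl⟩ := (Abelian.Ext.homEquiv (X := X) (Y := Y) (n := n + 1)).surjective f
  rw [Abelian.Ext.eq_zero_of_projective e]
  exact Abelian.Ext.zero_hom X Y (n + 1)

theorem singleFunctor_hom_eq_zero_of_injective (X Y : C) [Injective Y] {k : ℤ} (hk : 0 < k)
    (f : (singleFunctor C 0).obj X ⟶ ((singleFunctor C 0).obj Y)⟦k⟧) : f = 0 := by
  have : HasExt.{max u v} C := HasExt.standard C
  obtain ⟨n, rfl⟩ : ∃ n : ℕ, k = (n + 1 : ℕ) := ⟨k.toNat - 1, by omega⟩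
  obtain ⟨e, rfl⟩ := (Abelian.Ext.homEquiv (X := X) (Y := Y) (n := n + 1)).surjective f
  rw [Abelian.Ext.eq_zero_of_injective e]
  exact Abelian.Ext.zero_hom X Y (n + 1)

variable (C) in
/-- An object of an abelian category as a complex concentrated in degree `0`, in the bounded derived
category. -/
def boundedSingle : C ⥤ Bounded C :=
  ObjectProperty.lift _ (singleFunctor C 0) fun _ => ⟨⟨0, inferInstance⟩, ⟨0, inferInstance⟩⟩

theorem isExceptionalObject_boundedSingle {X : C}
    (hX : Function.Bijective fun c : K => c • 𝟙 X)
    (h : ∀ (k : ℤ), 0 < k →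
      ∀ f : (singleFunctor C 0).obj X ⟶ ((singleFunctor C 0).obj X)⟦k⟧, f = 0) :
    IsExceptionalObject K ((boundedSingle C).obj X) := by
  refine .of_map Bounded.ι (?_ : IsExceptionalObject K ((singleFunctor C 0).obj X))
  constructor
  · have hfun : (fun c : K => c • 𝟙 ((singleFunctor C 0).obj X)) =
        (singleFunctor C 0).map ∘ fun c : K => c • 𝟙 X := by
      ext c
      rw [Function.comp_apply, Functor.map_smul, CategoryTheory.Functor.map_id]
    rw [hfun]
    exact ((Functor.FullyFaithful.ofFullyFaithful (singleFunctor C 0)).map_bijective X X).comp hX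
  · intro k hk f
    rcases hk.lt_or_gt with hlt | hgt
    · exact singleFunctor_hom_eq_zero_of_neg _ _ hlt f
    · exact h k hgt f

theorem exists_boundedSingle_hom_ne_zero {X Y : C} {f : X ⟶ Y} (hf : f ≠ 0) :
    ∃ g : (boundedSingle C).obj X ⟶ ((boundedSingle C).obj Y)⟦(0 : ℤ)⟧, g ≠ 0 := by
  obtain ⟨g, hg⟩ := exists_hom_shift_zero_ne_zero
    (fun h => hf ((singleFunctor C 0).map_injective (h.trans (Functor.map_zero _ _ _).symm)) :
      (singleFunctor C 0).map f ≠ 0)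
  exact exists_hom_ne_zero_of_map Bounded.ι (f := g) hg

/-- The connecting morphism of a non-split short exact sequence is not zero. -/
theorem exists_hom_ne_zero_of_shortExact {S : ShortComplex C} (hS : S.ShortExact)
    (hsplit : ∀ s : S.X₃ ⟶ S.X₂, s ≫ S.g ≠ 𝟙 S.X₃) :
    ∃ f : (boundedSingle C).obj S.X₃ ⟶ ((boundedSingle C).obj S.X₁)⟦(1 : ℤ)⟧, f ≠ 0 := by
  refine exists_hom_ne_zero_of_map Bounded.ι (f := hS.singleδ) fun h0 => ?_
  obtain ⟨s, hs⟩ := Triangle.coyoneda_exact₃ _ hS.singleTriangle_distinguished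
    (𝟙 ((singleFunctor C 0).obj S.X₃)) ((Category.id_comp _).trans h0)
  obtain ⟨t, rfl⟩ := (singleFunctor C 0).map_surjective s
  refine hsplit t ((singleFunctor C 0).map_injective ?_)
  rw [Functor.map_comp, CategoryTheory.Functor.map_id]
  exact hs.symm

/-- A projective object does not become a shift of an object to which it has no morphism. -/
theorem not_isShiftOf_boundedSingle {X Y : C} [Projective Y] (hY : ¬ IsZero Y)
    (h : ∀ f : Y ⟶ X, f = 0) :
    ¬ IsShiftOf ((boundedSingle C).obj X) ((boundedSingle C).obj Y) := by
  intro hXY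
  have hs : IsShiftOf ((singleFunctor C 0).obj Y) ((singleFunctor C 0).obj X) :=
    (hXY.symm.map Bounded.ι :)
  obtain ⟨k, ⟨e⟩⟩ := hs
  have he : e.hom = 0 := by
    rcases lt_trichotomy k 0 with hk | rfl | hk
    · exact singleFunctor_hom_eq_zero_of_neg _ _ hk _
    · let e₀ := (shiftFunctorZero (DerivedCategory C) ℤ).app ((singleFunctor C 0).obj X)
      obtain ⟨g, hg⟩ := (singleFunctor C 0).map_surjective (e.hom ≫ e₀.hom)
      rw [← cancel_mono e₀.hom, zero_comp, ← hg, h g, Functor.map_zero]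
    · exact singleFunctor_hom_eq_zero_of_projective _ _ hk _
  refine hY ((IsZero.iff_id_eq_zero Y).2 ((singleFunctor C 0).map_injective ?_))
  rw [CategoryTheory.Functor.map_id, Functor.map_zero, ← e.hom_inv_id, he, zero_comp]

end DerivedCategory

/-! ### Representations of the Kronecker quiver -/

namespace FGModuleCat

variable {K : Type w} [Field K]

instance (X : FGModuleCat.{w} K) : Projective X where
  factors f e _ := by
    have he : Function.Surjective e.hom.hom :=
      (ModuleCat.epi_iff_surjective _).1
        (inferInstanceAs (Epi ((forget₂ (FGModuleCat K) (ModuleCat K)).map e)))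
    obtain ⟨s, hs⟩ := e.hom.hom.exists_rightInverse_of_surjective (LinearMap.range_eq_top.2 he)
    refine ⟨f ≫ FGModuleCat.ofHom s, ?_⟩
    ext x
    exact LinearMap.congr_fun hs (f.hom.hom x)

instance (X : FGModuleCat.{w} K) : Injective X where
  factors f i _ := by
    have hi : Function.Injective i.hom.hom :=
      (ModuleCat.mono_iff_injective _).1
        (inferInstanceAs (Mono ((forget₂ (FGModuleCat K) (ModuleCat K)).map i)))
    obtain ⟨s, hs⟩ := i.hom.hom.exists_leftInverse_of_injective (LinearMap.ker_eq_bot.2 hi)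
    refine ⟨FGModuleCat.ofHom s ≫ f, ?_⟩
    ext x
    exact congrArg f.hom.hom (LinearMap.congr_fun hs x)

instance : HasFiniteBiproducts (FGModuleCat.{w} K) := Abelian.hasFiniteBiproducts

theorem bijective_smul_id_self :
    Function.Bijective fun c : K => c • 𝟙 (FGModuleCat.of K K) := by
  constructor
  · intro c d h
    have h' := LinearMap.congr_fun (congrArg (fun f => f.hom.hom) h) (1 : K)
    change c • (1 : K) = d • (1 : K) at h'
    simpa using h'
  · intro f
    refine ⟨f.hom.hom (1 : K), ?_⟩
    ext
    change f.hom.hom (1 : K) • (1 : K) = f.hom.hom (1 : K)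
    rw [smul_eq_mul, mul_one]

theorem not_isZero_self : ¬ IsZero (FGModuleCat.of K K) := fun h =>
  one_ne_zero (bijective_smul_id_self.1 (h.eq_of_src _ _) : (1 : K) = 0)

end FGModuleCat

namespace Kronecker

variable {K : Type w} [Field K] {m : ℕ}

/-- The source vertex, as an object of the path category. -/
abbrev source (m : ℕ) : Paths (KroneckerVertex m) := (Paths.of _).obj .source

/-- The sink vertex, as an object of the path category. -/
abbrev sink (m : ℕ) : Paths (KroneckerVertex m) := (Paths.of _).obj .sink

/-- The `i`-th arrow, as a morphism of the path category. -/
def arrow (i : Fin m) : source m ⟶ sink m :=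
  (Paths.of (KroneckerVertex m)).map (X := .source) (Y := .sink) i

theorem hom_ext {X Y : KroneckerRep K m} {f g : X ⟶ Y}
    (h₁ : f.app (source m) = g.app (source m)) (h₂ : f.app (sink m) = g.app (sink m)) : f = g := by
  ext x : 2
  cases x with
  | source => exact h₁
  | sink => exact h₂

/-- A morphism of representations from its components at the two vertices. -/
def homMk {X Y : KroneckerRep K m} (f₁ : X.obj (source m) ⟶ Y.obj (source m))
    (f₂ : X.obj (sink m) ⟶ Y.obj (sink m))
    (h : ∀ i, X.map (arrow i) ≫ f₂ = f₁ ≫ Y.map (arrow i)) : X ⟶ Y where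
  app x := match x with
    | .source => f₁
    | .sink => f₂
  naturality x y p := by
    induction p using Paths.induction with
    | id => simp
    | comp p q ih =>
      rename_i u v w
      rw [X.map_comp, Y.map_comp, Category.assoc]
      rw [← reassoc_of% ih]
      congr 1
      match v, w, q with
      | .source, .sink, i => exact h i

/-- The representation with given spaces at the two vertices and given maps between them. -/
def mk (V₁ V₂ : FGModuleCat.{w} K) (a : Fin m → (V₁ ⟶ V₂)) : KroneckerRep K m :=
  Paths.lift
    { obj := fun x => match x with
        | .source => V₁
        | .sink => V₂
      map := fun {x y} q => match x, y, q with
        | .source, .sink, i => a i }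

theorem mk_map_arrow (V₁ V₂ : FGModuleCat.{w} K) (a : Fin m → (V₁ ⟶ V₂)) (i : Fin m) :
    (mk V₁ V₂ a).map (arrow i) = a i := by
  exact Paths.lift_toPath _ _

open scoped ZeroObject

variable (K m)

/-- The simple representation at the sink, which is projective. -/
def simpleSink : KroneckerRep K m := mk 0 (FGModuleCat.of K K) fun _ => 0

/-- The simple representation at the source, which is injective. -/
def simpleSource : KroneckerRep K m := mk (FGModuleCat.of K K) 0 fun _ => 0

/-- The indecomposable projective representation at the source. -/
def projSource : KroneckerRep K m :=
  mk (FGModuleCat.of K K) (⨁ fun _ : Fin m => FGModuleCat.of K K)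
    fun i => biproduct.ι (fun _ : Fin m => FGModuleCat.of K K) i

/-- The representation in which all arrows act as the identity of a one-dimensional space. -/
def diagonal : KroneckerRep K m := mk (FGModuleCat.of K K) (FGModuleCat.of K K) fun _ => 𝟙 _

variable {K m}

theorem isZero_simpleSink_source : IsZero ((simpleSink K m).obj (source m)) := isZero_zero _

theorem isZero_simpleSource_sink : IsZero ((simpleSource K m).obj (sink m)) := isZero_zero _

theorem projSource_map_arrow (i : Fin m) : (projSource K m).map (arrow i) =
    biproduct.ι (fun _ : Fin m => FGModuleCat.of K K) i :=
  mk_map_arrow _ _ _ i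

/-- Morphisms from the simple representation at the sink. -/
def simpleSinkDesc {X : KroneckerRep K m} (f : FGModuleCat.of K K ⟶ X.obj (sink m)) :
    simpleSink K m ⟶ X :=
  homMk 0 f fun _ => isZero_simpleSink_source.eq_of_src _ _

/-- Morphisms to the simple representation at the source. -/
def simpleSourceLift {X : KroneckerRep K m} (f : X.obj (source m) ⟶ FGModuleCat.of K K) :
    X ⟶ simpleSource K m :=
  homMk f 0 fun _ => isZero_simpleSource_sink.eq_of_tgt _ _

/-- Morphisms from the indecomposable projective representation at the source. -/
def projSourceDesc {X : KroneckerRep K m} (f : FGModuleCat.of K K ⟶ X.obj (source m)) :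
    projSource K m ⟶ X :=
  homMk f (biproduct.desc fun i => f ≫ X.map (arrow i)) fun i => by
    exact (congrArg (· ≫ _) (projSource_map_arrow i)).trans (biproduct.ι_desc _ i)

theorem simpleSink_hom_ext {X : KroneckerRep K m} {f g : simpleSink K m ⟶ X}
    (h : f.app (sink m) = g.app (sink m)) : f = g :=
  hom_ext (isZero_simpleSink_source.eq_of_src _ _) h

theorem simpleSource_hom_ext {X : KroneckerRep K m} {f g : X ⟶ simpleSource K m}
    (h : f.app (source m) = g.app (source m)) : f = g :=
  hom_ext h (isZero_simpleSource_sink.eq_of_tgt _ _)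

theorem projSource_hom_ext {X : KroneckerRep K m} {f g : projSource K m ⟶ X}
    (h : f.app (source m) = g.app (source m)) : f = g := by
  refine hom_ext h (biproduct.hom_ext' _ _ fun i => ?_)
  have hf := f.naturality (arrow i)
  rw [h, ← g.naturality (arrow i)] at hf
  exact (congrArg (· ≫ f.app _) (projSource_map_arrow i)).symm.trans
    (hf.trans (congrArg (· ≫ g.app _) (projSource_map_arrow i)))

instance : Projective (simpleSink K m) where
  factors f e _ := by
    refine ⟨simpleSinkDesc (Projective.factorThru (P := FGModuleCat.of K K)
      (f.app (sink m)) (e.app (sink m))), simpleSink_hom_ext ?_⟩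
    exact Projective.factorThru_comp (P := FGModuleCat.of K K) (f.app (sink m)) (e.app (sink m))

instance : Projective (projSource K m) where
  factors f e _ := by
    refine ⟨projSourceDesc (Projective.factorThru (P := FGModuleCat.of K K)
      (f.app (source m)) (e.app (source m))), projSource_hom_ext ?_⟩
    exact Projective.factorThru_comp (P := FGModuleCat.of K K) (f.app (source m))
      (e.app (source m))

instance : Injective (simpleSource K m) where
  factors f i _ := by
    refine ⟨simpleSourceLift (Injective.factorThru (J := FGModuleCat.of K K)
      (f.app (source m)) (i.app (source m))), simpleSource_hom_ext ?_⟩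
    exact Injective.comp_factorThru (J := FGModuleCat.of K K) (f.app (source m))
      (i.app (source m))

/-- A representation that is one-dimensional at a vertex at which its endomorphisms are determined
has only scalar endomorphisms. -/
theorem bijective_smul_id {X : KroneckerRep K m} (x : Paths (KroneckerVertex m))
    (e : X.obj x = FGModuleCat.of K K)
    (hX : ∀ f g : X ⟶ X, f.app x = g.app x → f = g) :
    Function.Bijective fun c : K => c • 𝟙 X := by
  have h : Function.Bijective fun c : K => c • 𝟙 (X.obj x) := by
    rw [e]
    exact FGModuleCat.bijective_smul_id_self
  constructor
  · intro c d hcd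
    exact h.1 (congrArg (fun f => f.app x) hcd)
  · intro f
    obtain ⟨c, hc⟩ := h.2 (f.app x)
    exact ⟨c, hX _ _ hc⟩

theorem isExceptionalObject_simpleSink :
    IsExceptionalObject K ((boundedSingle (KroneckerRep K m)).obj (simpleSink K m)) :=
  isExceptionalObject_boundedSingle
    (bijective_smul_id (sink m) rfl fun _ _ h => simpleSink_hom_ext h)
    fun _ hk => singleFunctor_hom_eq_zero_of_projective _ _ hk

theorem isExceptionalObject_simpleSource :
    IsExceptionalObject K ((boundedSingle (KroneckerRep K m)).obj (simpleSource K m)) :=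
  isExceptionalObject_boundedSingle
    (bijective_smul_id (source m) rfl fun _ _ h => simpleSource_hom_ext h)
    fun _ hk => singleFunctor_hom_eq_zero_of_injective _ _ hk

theorem isExceptionalObject_projSource :
    IsExceptionalObject K ((boundedSingle (KroneckerRep K m)).obj (projSource K m)) :=
  isExceptionalObject_boundedSingle
    (bijective_smul_id (source m) rfl fun _ _ h => projSource_hom_ext h)
    fun _ hk => singleFunctor_hom_eq_zero_of_projective _ _ hk

theorem simpleSink_hom_simpleSource (f : simpleSink K m ⟶ simpleSource K m) : f = 0 :=
  simpleSink_hom_ext (isZero_simpleSource_sink.eq_of_tgt _ _)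

theorem not_isZero_simpleSink : ¬ IsZero (simpleSink K m) := fun h =>
  FGModuleCat.not_isZero_self (K := K)
    (((evaluation _ (FGModuleCat.{w} K)).obj (sink m)).map_isZero h)

theorem exists_simpleSink_hom_projSource (hm : 0 < m) :
    ∃ f : simpleSink K m ⟶ projSource K m, f ≠ 0 := by
  refine ⟨simpleSinkDesc (biproduct.ι (fun _ : Fin m => FGModuleCat.of K K) ⟨0, hm⟩), fun h => ?_⟩
  have h' : biproduct.ι (fun _ : Fin m => FGModuleCat.of K K) ⟨0, hm⟩ = 0 :=
    congrArg (fun f => f.app (sink m)) h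
  refine FGModuleCat.not_isZero_self (K := K) ((IsZero.iff_id_eq_zero _).2 ?_)
  rw [← biproduct.ι_π_self (fun _ : Fin m => FGModuleCat.of K K) ⟨0, hm⟩, h', zero_comp]

theorem exists_projSource_hom_simpleSource :
    ∃ f : projSource K m ⟶ simpleSource K m, f ≠ 0 := by
  refine ⟨projSourceDesc (𝟙 (FGModuleCat.of K K)), fun h => ?_⟩
  have h' : 𝟙 (FGModuleCat.of K K) = 0 := congrArg (fun f => f.app (source m)) h
  exact FGModuleCat.not_isZero_self (K := K) ((IsZero.iff_id_eq_zero _).2 h')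

variable (K m) in
/-- The extension of the simple representation at the source by the simple representation at the
sink whose middle term is the diagonal representation. -/
def diagonalSequence : ShortComplex (KroneckerRep K m) :=
  ShortComplex.mk (simpleSinkDesc (X := diagonal K m) (𝟙 (FGModuleCat.of K K)))
    (simpleSourceLift (𝟙 (FGModuleCat.of K K))) (simpleSink_hom_simpleSource _)

theorem diagonalSequence_shortExact : (diagonalSequence K m).ShortExact := by
  have hmono : Mono (diagonalSequence K m).f := by
    have (x : Paths (KroneckerVertex m)) : Mono ((diagonalSequence K m).f.app x) := by
      cases x with
      | source => exact isZero_simpleSink_source.mono _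
      | sink => exact inferInstanceAs (Mono (𝟙 (FGModuleCat.of K K)))
    exact NatTrans.mono_of_mono_app _
  have hepi : Epi (diagonalSequence K m).g := by
    have (x : Paths (KroneckerVertex m)) : Epi ((diagonalSequence K m).g.app x) := by
      cases x with
      | source => exact inferInstanceAs (Epi (𝟙 (FGModuleCat.of K K)))
      | sink => exact isZero_simpleSource_sink.epi _
    exact NatTrans.epi_of_epi_app _
  refine .mk' (ShortComplex.exact_of_f_is_kernel _ (KernelFork.IsLimit.ofι' _ _ fun {X} k hk => ?_))
    hmono hepi
  have h₁ : k.app (source m) = 0 :=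
    (Category.comp_id (k.app (source m))).symm.trans (congrArg (fun f => f.app (source m)) hk)
  refine ⟨homMk 0 (k.app (sink m)) fun i => ?_, ?_⟩
  · refine (k.naturality (arrow i)).trans ?_
    exact (congrArg (· ≫ _) h₁).trans (zero_comp.trans zero_comp.symm)
  · refine hom_ext ?_ (Category.comp_id _)
    exact zero_comp.trans h₁.symm

/-- The extension `diagonalSequence` does not split: a section would be determined by its value at
the source, which the arrows, acting injectively, would have to annihilate. -/
theorem diagonalSequence_not_split (hm : 0 < m)
    (s : (diagonalSequence K m).X₃ ⟶ (diagonalSequence K m).X₂) :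
    s ≫ (diagonalSequence K m).g ≠ 𝟙 _ := by
  intro h
  have h₁ : s.app (source m) = 𝟙 (FGModuleCat.of K K) :=
    (Category.comp_id (s.app (source m))).symm.trans (congrArg (fun f => f.app (source m)) h)
  have h₂ := s.naturality (arrow ⟨0, hm⟩)
  have h₃ : (diagonalSequence K m).X₂.map (arrow ⟨0, hm⟩) = 𝟙 (FGModuleCat.of K K) :=
    mk_map_arrow _ _ _ _
  have h₄ : s.app (source m) ≫ (diagonalSequence K m).X₂.map (arrow ⟨0, hm⟩) =
      𝟙 (FGModuleCat.of K K) := by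
    rw [h₁, h₃]
    exact Category.comp_id _
  refine FGModuleCat.not_isZero_self (K := K) ((IsZero.iff_id_eq_zero _).2 ?_)
  rw [← h₄, ← h₂, show s.app (sink m) = 0 from isZero_simpleSource_sink.eq_of_src _ _]
  exact comp_zero

end Kronecker

/-! ### Non-commutative curves -/

theorem IsSigmaExceptionalCollection.curves_eq_empty {K : Type w} [Field K] {T : Type u}
    [Category.{v} T] [HasZeroObject T] [HasShift T ℤ] [Preadditive T] [Linear K T]
    [∀ m : ℤ, (shiftFunctor T m).Additive] [Pretriangulated T] [IsTriangulated T]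
    {σ : StabilityCondition T} {n : ℕ} {E : Fin (n + 1) → T}
    (hσ : IsSigmaExceptionalCollection K σ E)
    (hfull : IsFullExceptionalCollection K E) (hphase : StrictMono fun i => σ.phase (E i)) {l : ℕ}
    {𝓔 : Set (NP K l)} (h𝓔 : IsExceptionalTransversal K 𝓔) :
    stableCurves σ 𝓔 = ∅ ∧ semistableCurves σ 𝓔 = ∅ := by
  constructor
  · refine Set.image_eq_empty.2 (Set.eq_empty_of_forall_notMem fun F hF => ?_)
    obtain ⟨f, hf⟩ := exists_boundedSingle_hom_ne_zero
      (Kronecker.exists_simpleSink_hom_projSource (K := K) l.succ_pos).choose_spec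
    obtain ⟨g, hg⟩ := exists_boundedSingle_hom_ne_zero
      (Kronecker.exists_projSource_hom_simpleSource (K := K) (m := l + 1)).choose_spec
    obtain ⟨h, hh⟩ := exists_hom_ne_zero_of_shortExact
      (Kronecker.diagonalSequence_shortExact (K := K) (m := l + 1))
      (Kronecker.diagonalSequence_not_split l.succ_pos)
    exact hσ.not_forall_semistable hfull hphase F.functor h𝓔
      Kronecker.isExceptionalObject_simpleSink Kronecker.isExceptionalObject_projSource
      Kronecker.isExceptionalObject_simpleSource hf hg hh
      (not_isShiftOf_boundedSingle Kronecker.not_isZero_simpleSink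
        Kronecker.simpleSink_hom_simpleSource) hF
  · exact Set.image_eq_empty.2 (Set.eq_empty_of_forall_notMem fun F hF =>
      hF (hσ.finite_semistable_image hfull hphase F.functor h𝓔))

end

theorem corollary5p5 {K : Type w} [Field K] {T : Type u} [Category.{v} T] [HasZeroObject T]
    [HasShift T ℤ] [Preadditive T] [Linear K T] [∀ m : ℤ, (shiftFunctor T m).Additive]
    [∀ m : ℤ, (shiftFunctor T m).Linear K] [Pretriangulated T] [IsTriangulated T]
    (σ : StabilityCondition T) (n : ℕ) (E : Fin (n + 1) → T)
    (hfull : IsFullExceptionalCollection K E)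
    (hσ : IsSigmaExceptionalCollection K σ E)
    (hphase : StrictMono fun i => σ.phase (E i)) :
    (∀ (i : Fin (n + 1)) (j : ℤ), σ.P (σ.phase (E i) + j) = shiftedExtensionClosure (E i) j) ∧
    (∀ t : ℝ, (∀ (i : Fin (n + 1)) (j : ℤ), t ≠ σ.phase (E i) + j) →
      ∀ X : T, σ.P t X ↔ IsZero X) ∧
    stableDerivedPoints K σ = Set.range (fun i => triangulatedSpan {E i}) ∧
    (stableDerivedPoints K σ).Finite ∧
    ∀ (l : ℕ) (𝓔 : Set (NP K l)), IsExceptionalTransversal K 𝓔 →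
      stableCurves σ 𝓔 = ∅ ∧ semistableCurves σ 𝓔 = ∅ := by
  refine ⟨hσ.prop_eq_shiftedExtensionClosure hfull hphase,
    fun t ht X => ⟨fun hX => ?_, fun hX => ?_⟩, hσ.stableDerivedPoints_eq hfull hphase, ?_,
    fun l 𝓔 h𝓔 => hσ.curves_eq_empty hfull hphase h𝓔⟩
  · by_contra h0
    obtain ⟨i, j, h⟩ := hσ.exists_eq_phase_add hfull hphase hX h0
    exact ht i j h
  · have := σ.additive t
    exact prop_of_isZero_of_isClosedUnderFiniteProducts _ hX
  · rw [hσ.stableDerivedPoints_eq hfull hphase]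
    exact Set.finite_range _
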